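/- **Setting.** Let $X$ be a finite set, $C=(C_{x,y})_{x,y\in X}$ a symmetric nonnegative matrix with zero diagonal, and $\kappa=(\kappa_x)_{x\in X}$ a nonnegative measure. Put $\lambda_x=\kappa_x+\sum_y C_{x,y}$ and assume $\lambda_x>0$ for all $x$ and that the energy $e(z)=\frac12\sum_{x,y}C_{x,y}|z^x-z^y|^2+\sum_x\kappa_x|z^x|^2$ has a mass gap: for some $\varepsilon>0$, $e(z)\ge\varepsilon\sum_x\lambda_x|z^x|^2$ for all $z:X\to\mathbb C$. Let $P^x_y=C_{x,y}/\lambda_x$ and $G=(M_\lambda-C)^{-1}$, where $M_f$ is the diagonal matrix with entries $f$. The pair $\{x,y\}$ in $X$ is a link if $C_{x,y}>0$. *Transfer matrix.* Add a cemetery point: $X^\Delta=X\cup\{\Delta\}$, $C_{x,\Delta}=C_{\Delta,x}=\kappa_x$, $C_{\Delta,\Delta}=0$, $\lambda_\Delta=\sum_x\kappa_x$, and $[P^R]^x_y=C_{x,y}/\lambda_x$ on $X^\Delta$. For a signed measure $\nu$ on $X^\Delta$ of total charge zero, $G^R\nu$ is the function $f$ on $X^\Delta$ with $\sum_x\lambda_xf^x=0$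 and $(I-P^R)f=\nu/\lambda$. For $x\ne y$, $u\ne v$ in $X^\Delta$ let $$K^{(x,y),(u,v)}=G^R(\delta_x-\delta_y)^u-G^R(\delta_x-\delta_y)^v .$$ Choose an orientation of each unordered pair of distinct points of $X^\Delta$, and regard $K$ as a matrix indexed by these pairs. *Loops.* A based loop with $p$ points visits $\xi_1,\dots,\xi_p\in X$ in this order, jumping at times $0<T_1<\dots<T_p<T$, and is back at $\xi_1$ at its total time $T$ (for $p=1$ it stays at $\xi_1$ and does not jump). Let $\mu_0$ be the measure on based loops given by $\mu_0(p=1,\xi_1=x,T\in dt)=\frac{e^{-t}}t\,dt$ and, for $k\ge2$, $$\mu_0(p=k,\xi_1=x_1,\dots,\xi_k=x_k,T_1\in dt_1,\dots,T_k\in dt_k,T\in dt)=P^{x_1}_{x_2}\cdots P^{x_k}_{x_1}\,1_{\{0<t_1<\dots<t_k<t\}}\frac{e^{-t}}t\,dt_1\cdots dt_k\,dt .$$ Loops are based loops up to time shift, and $\mu$ is the image of $\mu_0$ on loops. For a loop with $p\ge2$, $N_{x,y}=\#\{i:\xi_i=x,\ \xi_{i+1}=y\}$ (cyclic indices), and $N_{x,y}=0$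 for $p=1$. For $\alpha>0$ let $\mathcal L_\alpha$ be a Poisson point process of loops with intensity $\alpha\mu$, on any probability space, and put $N_{x,y}^{(\alpha)}=\sum_{l\in\mathcal L_\alpha}N_{x,y}(l)$. **Statement.** Let $g$ be a real function on unordered pairs of points of $X^\Delta$, nonnegative on the links of $X$. For distinct $x,y\in X$ put $Tg(\{x,y\})=C_{x,y}(1-e^{-g(\{x,y\})})$, for every $x\in X$ put $Tg(\{x,\Delta\})=\sum_{z\in X}C_{x,z}(e^{-g(\{x,z\})}-1)$, and let $M(g)=M_{Tg}$ be the corresponding diagonal matrix indexed by the unordered pairs of distinct points of $X^\Delta$. Let $C(1-e^{-g})$ denote the $X\times X$ matrix with entries $C_{x,y}(1-e^{-g(\{x,y\})})$. Then, almost surely, all $N^{(\alpha)}_{x,y}$ are finite; the variable $e^{-\sum_{x,y\in X}g(\{x,y\})N^{(\alpha)}_{x,y}}$ is integrable; the two determinants below are positive; and $$\det\bigl(I+G\,C(1-e^{-g})\bigr)^{-\alpha}=\mathbb E\Bigl(e^{-\sum_{x,y\in X}g(\{x,y\})N^{(\alpha)}_{x,y}}\Bigr)=\det\bigl(I-K\,M(g)\bigr)^{-\alpha},$$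 for every choice of the orientation. -/

import Mathlib

open MeasureTheory ProbabilityTheory
open scoped ENNReal Matrix

noncomputable section

namespace MarkovLoops

/-! ### Energy forms on a finite space -/

/-- `λ_x = κ_x + ∑_y C_{x,y}`. -/
def totalMass {X : Type*} [Fintype X] (C : X → X → ℝ) (κ : X → ℝ) (x : X) : ℝ :=
  κ x + ∑ y, C x y

/-- The energy `e(z) = ½ ∑_{x,y} C_{x,y} |z^x - z^y|² + ∑_x κ_x |z^x|²` of a complex function. -/
def energy {X : Type*} [Fintype X] (C : X → X → ℝ) (κ : X → ℝ) (z : X → ℂ) : ℝ :=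
  (1 / 2) * ∑ x, ∑ y, C x y * ‖z x - z y‖ ^ 2 + ∑ x, κ x * ‖z x‖ ^ 2

/-- The free parameters of the model: a symmetric nonnegative conductance matrix with zero
diagonal and a nonnegative killing measure, such that `λ` is a positive measure and the energy
has a mass gap (the time scale is `q = 1`, for which `m = λ`). -/
structure EnergyForm (X : Type*) [Fintype X] where
  /-- the conductances `C_{x,y}` -/
  C : X → X → ℝ
  /-- the killing measure `κ_x` -/
  κ : X → ℝ
  C_symm : ∀ x y, C x y = C y x
  C_nonneg : ∀ x y, 0 ≤ C x y
  C_diag : ∀ x, C x x = 0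
  κ_nonneg : ∀ x, 0 ≤ κ x
  lam_pos : ∀ x, 0 < totalMass C κ x
  mass_gap : ∃ ε : ℝ, 0 < ε ∧
    ∀ z : X → ℂ, ε * ∑ x, totalMass C κ x * ‖z x‖ ^ 2 ≤ energy C κ z

namespace EnergyForm

variable {X : Type*} [Fintype X] (E : EnergyForm X)

/-- The measure `λ` on `X`. -/
def lam (x : X) : ℝ := totalMass E.C E.κ x

/-- The transition matrix `P^x_y = C_{x,y} / λ_x` on `X`. -/
def P (x y : X) : ℝ := E.C x y / E.lam x

/-- The Green function `G = (M_λ - C)⁻¹`. -/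
def green [DecidableEq X] : Matrix X X ℝ := (Matrix.diagonal E.lam - Matrix.of E.C)⁻¹

/-- The matrix `C (1 - e^{-g})`, with entries `C_{x,y} (1 - e^{-g({x,y})})`. -/
def perturbation (g : Sym2 (Option X) → ℝ) : Matrix X X ℝ :=
  Matrix.of fun x y => E.C x y * (1 - Real.exp (-g s(some x, some y)))

/-! ### The recurrent chain on `X^Δ` (the cemetery `Δ` is `none : Option X`) -/

/-- The conductances extended to `X^Δ` by `C_{x,Δ} = C_{Δ,x} = κ_x`. -/
def extC : Option X → Option X → ℝ
  | some x, some y => E.C x y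
  | some x, none => E.κ x
  | none, some y => E.κ y
  | none, none => 0

/-- `λ` extended to `X^Δ` by `λ_Δ = ∑_x κ_x`. -/
def extLam : Option X → ℝ
  | some x => E.lam x
  | none => ∑ x, E.κ x

/-- The operator `I - P^R`, where `[P^R]^x_y = C_{x,y} / λ_x` on `X^Δ`. -/
def idSubPR (f : Option X → ℝ) (x : Option X) : ℝ :=
  f x - ∑ y, E.extC x y / E.extLam x * f y

/-- `V^R`, the inverse of the restriction of `I - P^R` to the space of functions on `X^Δ` of
zero `λ`-integral. -/
def recurrentPotential : (Option X → ℝ) → (Option X → ℝ) :=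
  Function.invFunOn E.idSubPR {f | ∑ x, E.extLam x * f x = 0}

/-- `G^R ν = V^R (ν / λ)`, for a signed measure `ν` on `X^Δ` of total charge zero. -/
def recurrentGreen (ν : Option X → ℝ) : Option X → ℝ :=
  E.recurrentPotential fun x => ν x / E.extLam x

/-- The transfer matrix
`K^{(x,y),(u,v)} = G^R(δ_x - δ_y)^u - G^R(δ_x - δ_y)^v`, on ordered pairs of points of `X^Δ`. -/
def transfer [DecidableEq X] (ξ η : Option X × Option X) : ℝ :=
  E.recurrentGreen (Pi.single ξ.1 1 - Pi.single ξ.2 1) η.1 -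
    E.recurrentGreen (Pi.single ξ.1 1 - Pi.single ξ.2 1) η.2

/-- `Tg` on ordered pairs: `C_{x,y} (1 - e^{-g({x,y})})` for `x, y` in `X`, and
`∑_z C_{x,z} (e^{-g({x,z})} - 1)` for the pairs formed by `x` in `X` and `Δ`. -/
def tiltAux (g : Sym2 (Option X) → ℝ) : Option X → Option X → ℝ
  | some x, some y => E.C x y * (1 - Real.exp (-g s(some x, some y)))
  | some x, none => ∑ z, E.C x z * (Real.exp (-g s(some x, some z)) - 1)
  | none, some x => ∑ z, E.C x z * (Real.exp (-g s(some x, some z)) - 1)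
  | none, none => 0

theorem tiltAux_symm (g : Sym2 (Option X) → ℝ) (a b : Option X) :
    E.tiltAux g a b = E.tiltAux g b a := by
  cases a <;> cases b <;> simp only [tiltAux]
  rw [E.C_symm, Sym2.eq_swap]

/-- The function `Tg` on non oriented links of `X^Δ`. -/
def tilt (g : Sym2 (Option X) → ℝ) : Sym2 (Option X) → ℝ :=
  Sym2.lift ⟨E.tiltAux g, E.tiltAux_symm g⟩

end EnergyForm

/-- Non oriented pairs `{x, y}` of distinct points of `X^Δ`. -/
abbrev Link (X : Type*) := {ξ : Sym2 (Option X) // ¬ ξ.IsDiag}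

/-- A choice of an orientation of every non oriented pair. -/
def IsOrientation {X : Type*} (o : Link X → Option X × Option X) : Prop :=
  ∀ ξ : Link X, s((o ξ).1, (o ξ).2) = (ξ : Sym2 (Option X))

namespace EnergyForm

variable {X : Type*} [Fintype X] [DecidableEq X] (E : EnergyForm X)

/-- The transfer matrix indexed by the non oriented pairs, each oriented by `o`. -/
def transferMatrix (o : Link X → Option X × Option X) : Matrix (Link X) (Link X) ℝ :=
  Matrix.of fun ξ η => E.transfer (o ξ) (o η)

/-- The multiplication operator `M(g) = M_{Tg}`. -/
def multTilt (g : Sym2 (Option X) → ℝ) : Matrix (Link X) (Link X) ℝ :=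
  Matrix.diagonal fun ξ => E.tilt g ξ

end EnergyForm

/-! ### Loops -/

/-- Based loops. `Sum.inl (x, t)` is the trivial loop which stays at `x` for the time `t`.
`Sum.inr ⟨n, ξ, τ⟩` has `p = n + 2` points: it stays at `ξ 0` for the time `τ 0`, then at `ξ 1`
for the time `τ 1`, …, then at `ξ (p - 1)` for the time `τ (p - 1)`, and at last it is back at
`ξ 0`, for the time `τ p`. -/
abbrev BasedLoop (X : Type*) :=
  (X × ℝ) ⊕ (Σ n : ℕ, (Fin (n + 2) → X) × (Fin (n + 3) → ℝ))

/-- The durations of the successive stays of a based loop run cyclically: the last and the first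
stay, both at `ξ 0`, are one stay of the loop. -/
def stay {n : ℕ} (τ : Fin (n + 3) → ℝ) (i : Fin (n + 2)) : ℝ :=
  if i = 0 then τ 0 + τ (Fin.last (n + 2)) else τ i.castSucc

/-- Two based loops differ by a shift of time iff the cyclic sequences of the points they visit,
with the durations of the stays there, agree up to a rotation. -/
inductive Shift {X : Type*} : BasedLoop X → BasedLoop X → Prop
  | trivial (a : X × ℝ) : Shift (Sum.inl a) (Sum.inl a)
  | rotate (n : ℕ) (ξ ξ' : Fin (n + 2) → X) (τ τ' : Fin (n + 3) → ℝ) (r : Fin (n + 2))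
      (hξ : ∀ i, ξ' i = ξ (i + r)) (hτ : ∀ i, stay τ' i = stay τ (i + r)) :
      Shift (Sum.inr ⟨n, ξ, τ⟩) (Sum.inr ⟨n, ξ', τ'⟩)

theorem shift_equivalence (X : Type*) : Equivalence (@Shift X) where
  refl := by
    rintro (a | ⟨n, ξ, τ⟩)
    · exact .trivial a
    · exact .rotate n ξ ξ τ τ 0 (by simp) (by simp)
  symm := by
    rintro _ _ (a | ⟨n, ξ, ξ', τ, τ', r, hξ, hτ⟩)
    · exact .trivial a
    · exact .rotate n _ _ _ _ (-r) (by simp [hξ]) (by simp [hτ])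
  trans := by
    rintro _ _ _ (a | ⟨n, ξ, ξ', τ, τ', r, hξ, hτ⟩) h
    · exact h
    · cases h with
      | rotate _ _ ξ'' _ τ'' r' hξ' hτ' =>
        exact .rotate n _ _ _ _ (r' + r) (by simp [hξ, hξ', add_assoc])
          (by simp [hτ, hτ', add_assoc])

instance shiftSetoid (X : Type*) : Setoid (BasedLoop X) := ⟨Shift, shift_equivalence X⟩

/-- Loops: based loops up to time shift (with the quotient σ-field). -/
abbrev Loop (X : Type*) := Quotient (shiftSetoid X)

/-- `N_{x,y} = #{i : ξ_i = x, ξ_{i+1} = y}` (cyclic indices) for a based loop; a trivial loop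
makes no step. -/
def basedCrossings {X : Type*} [DecidableEq X] (x y : X) : BasedLoop X → ℕ
  | Sum.inl _ => 0
  | Sum.inr ⟨_, ξ, _⟩ => (Finset.univ.filter fun i => ξ i = x ∧ ξ (i + 1) = y).card

theorem basedCrossings_shift {X : Type*} [DecidableEq X] (x y : X) (a b : BasedLoop X)
    (h : Shift a b) : basedCrossings x y a = basedCrossings x y b := by
  rcases h with (a | ⟨n, ξ, ξ', τ, τ', r, hξ, hτ⟩)
  · rfl
  · simp only [basedCrossings]
    symm
    refine Finset.card_equiv (Equiv.addRight r) fun i => ?_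
    simp [hξ, add_right_comm]

/-- The number `N_{x,y}` of steps from `x` to `y` of a loop. -/
def crossings {X : Type*} [DecidableEq X] (x y : X) : Loop X → ℕ :=
  Quotient.lift (basedCrossings x y) (basedCrossings_shift x y)

namespace EnergyForm

variable {X : Type*} [Fintype X] [MeasurableSpace X] (E : EnergyForm X)

/-- The measure on based loops
`μ₀(p = 1, ξ₁ = x, T ∈ dt) = t⁻¹ e^{-t} dt`, and, for `k ≥ 2`,
`μ₀(p = k, ξ₁ = x₁, …, ξ_k = x_k, T₁ ∈ dt₁, …, T_k ∈ dt_k, T ∈ dt)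
  = P^{x₁}_{x₂} ⋯ P^{x_k}_{x₁} 1_{0 < t₁ < ⋯ < t_k < t} t⁻¹ e^{-t} dt₁ ⋯ dt_k dt`,
written in the coordinates `τ` (the successive differences of `0, t₁, …, t_k, t`).
It is `∑_x ∫₀^∞ t⁻¹ ℙ_t^{x,x} dt` for the chain with generator `P - I`. -/
def basedLoopMeasure : Measure (BasedLoop X) :=
  (∑ x : X, (((volume : Measure ℝ).restrict (Set.Ioi 0)).withDensity
      fun t => ENNReal.ofReal (Real.exp (-t) / t)).map fun t => Sum.inl (x, t)) +
  Measure.sum fun a : Σ n : ℕ, Fin (n + 2) → X =>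
    ENNReal.ofReal (∏ i, E.P (a.2 i) (a.2 (i + 1))) •
      (((volume : Measure (Fin (a.1 + 3) → ℝ)).restrict {τ | ∀ i, 0 < τ i}).withDensity
        fun τ => ENNReal.ofReal (Real.exp (-∑ i, τ i) / ∑ i, τ i)).map
          fun τ => Sum.inr ⟨a.1, a.2, τ⟩

/-- The loop measure `μ`, image of `μ₀` on the space of loops. -/
def loopMeasure : Measure (Loop X) :=
  E.basedLoopMeasure.map (Quotient.mk (shiftSetoid X))

end EnergyForm

/-! ### Poisson point processes -/

/-- `L` is a Poisson point process with intensity `ν` (seen as the random measure which counts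
its points): its values on disjoint sets are independent, and its value on `A` is Poisson
distributed with mean `ν A`, a Poisson variable with infinite mean being a.s. infinite. -/
structure IsPoissonPoint {Ω S : Type*} [MeasurableSpace Ω] [MeasurableSpace S]
    (Pr : Measure Ω) (L : Ω → Measure S) (ν : Measure S) : Prop where
  measurable : Measurable L
  law : ∀ A, MeasurableSet A → ν A ≠ ⊤ →
    Pr.map (fun ω => L ω A) = (poissonMeasure (ν A).toNNReal).map ((↑) : ℕ → ℝ≥0∞)
  law_top : ∀ A, MeasurableSet A → ν A = ⊤ → ∀ᵐ ω ∂Pr, L ω A = ⊤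
  indep : ∀ (n : ℕ) (A : Fin n → Set S), (∀ i, MeasurableSet (A i)) →
    Pairwise (fun i j => Disjoint (A i) (A j)) → iIndepFun (fun i ω => L ω (A i)) Pr

/-- `N_{x,y}^{(α)} = ∑_{l ∈ 𝓛} N_{x,y}(l)`, the number of steps from `x` to `y` of all the loops
of the family with counting measure `L`. -/
def totalCrossings {X : Type*} [DecidableEq X] [MeasurableSpace X] (L : Measure (Loop X))
    (x y : X) : ℝ≥0∞ :=
  ∫⁻ l, (crossings x y l : ℝ≥0∞) ∂L

end MarkovLoops

end

noncomputable section

namespace MarkovLoops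

/-! ### Determinants and traces of powers -/

/-! Both determinants are computed from the transition matrix `P`. Integrating out the holding times
gives a based loop with k ≥ 2 points the mass 1/k times the product of its transition probabilities.
Since exp(-∑ g N) factorises over the steps of a loop, ∫ (1 - exp(-∑ g N)) dμ is the sum over k ≥ 2
of (Tr P^k - Tr (P e^{-g})^k)/k, where P e^{-g} is the entrywise product. This equals log det(1 - P
e^{-g}) - log det(1 - P). Both series converge because the mass gap puts the eigenvalues of these
matrices, which are similar to symmetric ones, inside (-1, 1) (`abs_eigenvalues_symmetrized_lt_one`,
`lintegral_one_sub_exp`).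

The Laplace functional of a Poisson process (`integral_exp_neg_lintegral`) then makes the
expectation the power -α of det(1 - P e^{-g}) / det(1 - P). Factoring M_λ out of M_λ - C shows that
this ratio is det(1 + G C(1 - e^{-g})).

For the transfer matrix, let B be the incidence matrix of the oriented links, with the column of Δ
removed. Then K = B G Bᵀ (`transfer_eq`), while Bᵀ M(g) B is the Laplacian with conductances Tg. The
values of Tg on the links to Δ are exactly those that cancel its diagonal, so it equals -C(1 -
e^{-g}) (`incidence_mul`). Sylvester's identity det(1 - AB) = det(1 - BA) concludes. -/

/-- The expansion `-log det (1 - S) = ∑ Tr(S^k) / k` for a real symmetric matrix whose eigenvalues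
lie in `(-1, 1)`. -/
theorem log_det_one_sub_of_isHermitian {X : Type*} [Fintype X] [DecidableEq X] {S : Matrix X X ℝ}
    (hS : S.IsHermitian) (h : ∀ i, |hS.eigenvalues i| < 1) :
    0 < (1 - S).det ∧
      HasSum (fun n : ℕ => (S ^ (n + 1)).trace / (n + 1)) (-Real.log (1 - S).det) ∧
      Summable fun n : ℕ => (S ^ n).trace := by
  set U : Matrix X X ℝ := (hS.eigenvectorUnitary).1 with hU
  set D : Matrix X X ℝ := Matrix.diagonal hS.eigenvalues with hD
  have hUU : star U * U = 1 := Unitary.coe_star_mul_self hS.eigenvectorUnitary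
  have hUU' : U * star U = 1 := Unitary.coe_mul_star_self hS.eigenvectorUnitary
  have hSD : S = U * D * star U := by
    have := hS.spectral_theorem
    rw [Unitary.conjStarAlgAut_apply] at this
    exact this
  have hpow : ∀ n : ℕ, S ^ n = U * D ^ n * star U := by
    intro n
    induction n with
    | zero => simp [hUU']
    | succ n ih =>
      rw [pow_succ, ih]
      calc U * D ^ n * star U * S = U * D ^ n * star U * (U * D * star U) := by rw [← hSD]
        _ = U * D ^ n * (star U * U) * D * star U := by simp only [Matrix.mul_assoc]
        _ = _ := by rw [hUU, Matrix.mul_one, pow_succ, Matrix.mul_assoc U]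
  have htr : ∀ n : ℕ, (S ^ n).trace = ∑ i, hS.eigenvalues i ^ n := by
    intro n
    rw [hpow, Matrix.trace_mul_comm, ← Matrix.mul_assoc, hUU, Matrix.one_mul, hD,
      Matrix.diagonal_pow, Matrix.trace_diagonal]
    rfl
  have hdet : (1 - S).det = ∏ i, (1 - hS.eigenvalues i) := by
    have : 1 - S = U * (1 - D) * star U := by
      rw [Matrix.mul_sub, Matrix.sub_mul, Matrix.mul_one, hUU', ← hSD]
    rw [this, Matrix.det_mul_comm, ← Matrix.mul_assoc, hUU, Matrix.one_mul, hD,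
      ← Matrix.diagonal_one, Matrix.diagonal_sub, Matrix.det_diagonal]
  have hpos : ∀ i, 0 < 1 - hS.eigenvalues i := fun i => by linarith [(abs_lt.1 (h i)).2]
  refine ⟨hdet ▸ Finset.prod_pos fun i _ => hpos i, ?_, ?_⟩
  · rw [hdet, Real.log_prod fun i _ => (hpos i).ne', ← Finset.sum_neg_distrib]
    simp only [htr, Finset.sum_div]
    exact hasSum_sum fun i _ => Real.hasSum_pow_div_log_of_abs_lt_one (h i)
  · simp only [htr]
    exact summable_sum fun i _ => summable_geometric_of_abs_lt_one (h i)

/-! ### Spectral bound from the mass gap, and the Green function. -/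

namespace EnergyForm

variable {X : Type*} [Fintype X] (E : EnergyForm X)

theorem lam_pos' (x : X) : 0 < E.lam x := E.lam_pos x

/-- The mass gap, in terms of `C`. -/
theorem exists_quadratic_bound : ∃ ε : ℝ, 0 < ε ∧ ∀ z : X → ℝ,
    ∑ x, ∑ y, E.C x y * (z x * z y) ≤ (1 - ε) * ∑ x, E.lam x * z x ^ 2 := by
  obtain ⟨ε, hε, h⟩ := E.mass_gap
  refine ⟨ε, hε, fun z => ?_⟩
  have h1 := h fun x => (z x : ℂ)
  have h2 : energy E.C E.κ (fun x => (z x : ℂ)) =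
      ∑ x, E.lam x * z x ^ 2 - ∑ x, ∑ y, E.C x y * (z x * z y) := by
    simp only [energy, lam, totalMass, ← Complex.ofReal_sub, Complex.norm_real, Real.norm_eq_abs,
      sq_abs, add_mul, Finset.sum_add_distrib, Finset.sum_mul]
    have e1 : ∑ x, ∑ y, E.C x y * (z x - z y) ^ 2 = ∑ x, ∑ y, E.C x y * z x ^ 2 +
        ∑ x, ∑ y, E.C x y * z y ^ 2 - 2 * ∑ x, ∑ y, E.C x y * (z x * z y) := by
      simp only [Finset.mul_sum, ← Finset.sum_add_distrib, ← Finset.sum_sub_distrib]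
      exact Finset.sum_congr rfl fun x _ => Finset.sum_congr rfl fun y _ => by ring
    have e2 : ∑ x, ∑ y, E.C x y * z y ^ 2 = ∑ x, ∑ y, E.C x y * z x ^ 2 := by
      rw [Finset.sum_comm]
      exact Finset.sum_congr rfl fun x _ => Finset.sum_congr rfl fun y _ => by rw [E.C_symm]
    rw [e1, e2]
    ring
  rw [h2] at h1
  simp only [Complex.norm_real, Real.norm_eq_abs, sq_abs] at h1
  have : ε * ∑ x, E.lam x * z x ^ 2 ≤
    ∑ x, E.lam x * z x ^ 2 - ∑ x, ∑ y, E.C x y * (z x * z y) := h1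
  linarith

/-- The transition matrix `P` with its entries multiplied by the weights `w`. -/
def weighted (w : X → X → ℝ) : Matrix X X ℝ := Matrix.of fun x y => E.P x y * w x y

/-- The symmetric matrix similar to `weighted w`. -/
def symmetrized (w : X → X → ℝ) : Matrix X X ℝ :=
  Matrix.of fun x y => E.C x y * w x y / (√(E.lam x) * √(E.lam y))

variable {E} in
theorem symmetrized_isHermitian {w : X → X → ℝ} (hw : ∀ x y, w x y = w y x) :
    (E.symmetrized w).IsHermitian := by
  ext x y
  simp [symmetrized, hw y x, E.C_symm y x, mul_comm]

variable [DecidableEq X]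

/-- The Rayleigh quotient at a unit eigenvector v only grows when v is replaced by |v| and w by 1;
the mass gap then bounds it by 1 - ε. Taking absolute values controls both ends of the spectrum at
once. -/
theorem abs_eigenvalues_symmetrized_lt_one {w : X → X → ℝ} (hw : ∀ x y, w x y = w y x)
    (h0 : ∀ x y, 0 ≤ w x y) (h1 : ∀ x y, w x y ≤ 1) (i : X) :
    |(symmetrized_isHermitian (E := E) hw).eigenvalues i| < 1 := by
  obtain ⟨ε, hε, hq⟩ := E.exists_quadratic_bound
  set hS := symmetrized_isHermitian (E := E) hw
  set ρ := hS.eigenvalues i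
  set v : X → ℝ := ⇑(hS.eigenvectorBasis i) with hv
  have hnorm : ∑ x, v x ^ 2 = 1 := by
    have := hS.eigenvectorBasis.orthonormal.1 i
    rw [EuclideanSpace.norm_eq, Real.sqrt_eq_one] at this
    simpa using this
  have hSv : E.symmetrized w *ᵥ v = ρ • v := hS.mulVec_eigenvectorBasis i
  have hl : ∀ x, 0 < √(E.lam x) := fun x => Real.sqrt_pos.2 (E.lam_pos' x)
  have hρ : ρ = ∑ x, ∑ y, v x * (E.symmetrized w x y * v y) := by
    have : ∑ x, v x * (E.symmetrized w *ᵥ v) x = ρ := by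
      rw [hSv]
      calc ∑ x, v x * (ρ • v) x = ρ * ∑ x, v x ^ 2 := by
            rw [Finset.mul_sum]
            exact Finset.sum_congr rfl fun x _ => by simp; ring
        _ = ρ := by rw [hnorm, mul_one]
    rw [← this]
    simp only [Matrix.mulVec, dotProduct, Finset.mul_sum]
  have hle : |ρ| ≤ ∑ x, ∑ y, E.C x y * ((|v x| / √(E.lam x)) * (|v y| / √(E.lam y))) := by
    rw [hρ]
    refine (Finset.abs_sum_le_sum_abs _ _).trans (Finset.sum_le_sum fun x _ => ?_)
    refine (Finset.abs_sum_le_sum_abs _ _).trans (Finset.sum_le_sum fun y _ => ?_)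
    have hC := E.C_nonneg x y
    have := hl x
    have := hl y
    simp only [symmetrized, Matrix.of_apply, abs_mul, abs_div, abs_of_nonneg hC,
      abs_of_nonneg (h0 x y), abs_of_pos (hl x), abs_of_pos (hl y)]
    calc |v x| * (E.C x y * w x y / (√(E.lam x) * √(E.lam y)) * |v y|)
        ≤ |v x| * (E.C x y * 1 / (√(E.lam x) * √(E.lam y)) * |v y|) := by
          gcongr
          exact h1 x y
      _ = _ := by field_simp
  have hs : ∑ x, E.lam x * (|v x| / √(E.lam x)) ^ 2 = 1 := by
    rw [← hnorm]
    refine Finset.sum_congr rfl fun x _ => ?_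
    rw [div_pow, Real.sq_sqrt (E.lam_pos' x).le, sq_abs]
    field_simp [(E.lam_pos' x).ne']
  -- This test function has λ-norm 1, so the bound reads |ρ| ≤ 1 - ε.
  have := hq fun x => |v x| / √(E.lam x)
  rw [hs] at this
  linarith

/-- Conjugation by the diagonal matrix of √λ turns the weighted transition matrix into the symmetric
one, preserving traces of powers and the determinant. -/
theorem log_det_one_sub_weighted {w : X → X → ℝ} (hw : ∀ x y, w x y = w y x)
    (h0 : ∀ x y, 0 ≤ w x y) (h1 : ∀ x y, w x y ≤ 1) :
    0 < (1 - E.weighted w).det ∧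
      HasSum (fun n : ℕ => (E.weighted w ^ (n + 2)).trace / (n + 2))
        (-Real.log (1 - E.weighted w).det) ∧
      Summable fun n : ℕ => (E.weighted w ^ (n + 2)).trace := by
  obtain ⟨a, b, c⟩ := log_det_one_sub_of_isHermitian (symmetrized_isHermitian (E := E) hw)
    (E.abs_eigenvalues_symmetrized_lt_one hw h0 h1)
  set D : Matrix X X ℝ := Matrix.diagonal fun x => √(E.lam x)
  set D' : Matrix X X ℝ := Matrix.diagonal fun x => (√(E.lam x))⁻¹
  have hl : ∀ x, √(E.lam x) ≠ 0 := fun x => (Real.sqrt_pos.2 (E.lam_pos' x)).ne'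
  have hDD' : D * D' = 1 := by
    simp only [D, D', Matrix.diagonal_mul_diagonal, mul_inv_cancel₀ (hl _), Matrix.diagonal_one]
  have hD'D : D' * D = 1 := by
    simp only [D, D', Matrix.diagonal_mul_diagonal, inv_mul_cancel₀ (hl _), Matrix.diagonal_one]
  have hA : E.weighted w = D' * E.symmetrized w * D := by
    ext x y
    have h := Real.mul_self_sqrt (E.lam_pos' x).le
    simp only [D, D', Matrix.mul_diagonal, Matrix.diagonal_mul, weighted, symmetrized,
      Matrix.of_apply, P]
    nth_rewrite 1 [← h]
    field_simp [hl x, hl y]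
  have hpow : ∀ n : ℕ, E.weighted w ^ n = D' * E.symmetrized w ^ n * D := by
    intro n
    induction n with
    | zero => simp [hD'D]
    | succ n ih =>
      rw [pow_succ, ih, hA]
      calc D' * E.symmetrized w ^ n * D * (D' * E.symmetrized w * D)
          = D' * E.symmetrized w ^ n * (D * D') * E.symmetrized w * D := by
            simp only [Matrix.mul_assoc]
        _ = _ := by rw [hDD', Matrix.mul_one, pow_succ, Matrix.mul_assoc D']
  have htr : ∀ n : ℕ, (E.weighted w ^ n).trace = (E.symmetrized w ^ n).trace := fun n => by
    rw [hpow, Matrix.trace_mul_comm, ← Matrix.mul_assoc, hDD', Matrix.one_mul]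
  have hdet : (1 - E.weighted w).det = (1 - E.symmetrized w).det := by
    have : 1 - E.weighted w = D' * (1 - E.symmetrized w) * D := by
      rw [hA, Matrix.mul_sub, Matrix.sub_mul, Matrix.mul_one, hD'D]
    rw [this, Matrix.det_mul_comm, ← Matrix.mul_assoc, hDD', Matrix.one_mul]
  -- As C has zero diagonal, the term k = 1 vanishes and the series can start at k = 2, the least
  -- number of points of a nontrivial loop.
  have htr1 : (E.symmetrized w ^ 1).trace = 0 := by
    simp [Matrix.trace, symmetrized, E.C_diag]
  refine ⟨hdet ▸ a, ?_, ?_⟩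
  · rw [hdet]
    have := (hasSum_nat_add_iff' 1).2 b
    simp only [Finset.sum_range_one, zero_add, htr1, zero_div, sub_zero] at this
    refine this.congr_fun fun n => ?_
    rw [htr]
    push_cast
    ring
  · simp only [htr]
    exact (summable_nat_add_iff (f := fun n => (E.symmetrized w ^ n).trace) 2).2 c

/-- `M_λ - C = M_λ (1 - P)`. -/
theorem diagonal_mul_one_sub_weighted (w : X → X → ℝ) :
    Matrix.diagonal E.lam * (1 - E.weighted w) =
      Matrix.diagonal E.lam - Matrix.of fun x y => E.C x y * w x y := by
  rw [Matrix.mul_sub, Matrix.mul_one]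
  congr 1
  ext x y
  simp only [Matrix.diagonal_mul, weighted, Matrix.of_apply, P]
  field_simp [(E.lam_pos' x).ne']

theorem isUnit_diagonal_sub : IsUnit (Matrix.diagonal E.lam - Matrix.of E.C).det := by
  have h := E.diagonal_mul_one_sub_weighted fun _ _ => 1
  simp only [mul_one] at h
  have h' : (Matrix.of fun x y => E.C x y) = Matrix.of E.C := rfl
  rw [← h', ← h, Matrix.det_mul, Matrix.det_diagonal]
  have := (E.log_det_one_sub_weighted (w := fun _ _ => 1) (fun _ _ => rfl) (fun _ _ => zero_le_one)
    fun _ _ => le_rfl).1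
  exact (mul_pos (Finset.prod_pos fun x _ => E.lam_pos' x) this).ne'.isUnit

/-- `det (1 + G C(1 - e^{-g})) = det (1 - P e^{-g}) / det (1 - P)`. -/
theorem det_one_add_green_mul_perturbation (g : Sym2 (Option X) → ℝ) :
    (1 + E.green * E.perturbation g).det =
      (1 - E.weighted fun x y => Real.exp (-g s(some x, some y))).det /
        (1 - E.weighted fun _ _ => 1).det := by
  set A := Matrix.diagonal E.lam - Matrix.of E.C with hA
  have hu : IsUnit A.det := E.isUnit_diagonal_sub
  have e1 : A * (1 + E.green * E.perturbation g) = Matrix.diagonal E.lam *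
      (1 - E.weighted fun x y => Real.exp (-g s(some x, some y))) := by
    rw [E.diagonal_mul_one_sub_weighted, Matrix.mul_add, Matrix.mul_one, green, ← hA,
      ← Matrix.mul_assoc, Matrix.mul_nonsing_inv _ hu, Matrix.one_mul]
    ext x y
    simp [A, perturbation]
    ring
  have e2 : A = Matrix.diagonal E.lam * (1 - E.weighted fun _ _ => 1) := by
    rw [E.diagonal_mul_one_sub_weighted]
    simp only [mul_one]
    rfl
  have d1 := congrArg Matrix.det e1
  have d2 := congrArg Matrix.det e2
  rw [Matrix.det_mul, Matrix.det_mul] at d1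
  rw [Matrix.det_mul] at d2
  have hd : (Matrix.diagonal E.lam).det ≠ 0 := by
    rw [Matrix.det_diagonal]
    exact (Finset.prod_pos fun x _ => E.lam_pos' x).ne'
  have hA0 := hu.ne_zero
  rw [d2] at hA0 d1
  rw [eq_div_iff (right_ne_zero_of_mul hA0)]
  exact mul_left_cancel₀ hd (by linarith)

end EnergyForm

/-! ### The transfer matrix -/

namespace EnergyForm

/-- The charge `δ_u - δ_v` restricted to `X`. -/
def dipole {X : Type*} [DecidableEq X] (ξ : Option X × Option X) (x : X) : ℝ :=
  (Pi.single ξ.1 1 - Pi.single ξ.2 1 : Option X → ℝ) (some x)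

theorem dipole_mul_dipole {X : Type*} [DecidableEq X] (a b : Option X) (x y : X) :
    dipole (a, b) x * dipole (a, b) y = dipole (b, a) x * dipole (b, a) y := by
  simp only [dipole, Pi.sub_apply]
  ring

variable {X : Type*} [Fintype X] (E : EnergyForm X)

/-- The constant function 1 has energy equal to the total killing, so the mass gap forces λ_Δ > 0.
-/
theorem extLam_none_pos [Nonempty X] : 0 < E.extLam none := by
  obtain ⟨ε, hε, h⟩ := E.mass_gap
  have h1 := h fun _ => 1
  simp only [energy, sub_self, norm_zero, norm_one, one_pow, mul_one, ne_eq, OfNat.ofNat_ne_zero,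
    not_false_eq_true, zero_pow, mul_zero, Finset.sum_const_zero, zero_add] at h1
  have : 0 < ∑ x, totalMass E.C E.κ x :=
    Finset.sum_pos (fun x _ => E.lam_pos x) Finset.univ_nonempty
  exact (mul_pos hε this).trans_le h1

theorem extLam_pos [Nonempty X] : ∀ a, 0 < E.extLam a
  | none => E.extLam_none_pos
  | some x => E.lam_pos' x

theorem sum_extC (a : Option X) : ∑ b, E.extC a b = E.extLam a := by
  cases a <;> simp [Fintype.sum_option, extC, extLam, lam, totalMass]

theorem extC_symm (a b : Option X) : E.extC a b = E.extC b a := by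
  cases a <;> cases b <;> simp [extC, E.C_symm]

theorem extLam_mul_idSubPR [Nonempty X] (f : Option X → ℝ) (a : Option X) :
    E.extLam a * E.idSubPR f a = ∑ b, E.extC a b * (f a - f b) := by
  have h := (E.extLam_pos a).ne'
  simp only [idSubPR, mul_sub, Finset.mul_sum, Finset.sum_sub_distrib, ← Finset.sum_mul,
    E.sum_extC]
  congr 1
  exact Finset.sum_congr rfl fun b _ => by field_simp

/-- The total charge of `λ (1 - P^R) f` vanishes. -/
theorem sum_extLam_mul_idSubPR [Nonempty X] (f : Option X → ℝ) :
    ∑ a, E.extLam a * E.idSubPR f a = 0 := by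
  have h : ∑ a, E.extLam a * E.idSubPR f a = -∑ a, E.extLam a * E.idSubPR f a := by
    -- The summand C_{a,b} (f a - f b) is antisymmetric, so exchanging the two sums changes the
    -- sign.
    simp only [E.extLam_mul_idSubPR]
    conv_lhs => rw [Finset.sum_comm]
    rw [← Finset.sum_neg_distrib]
    refine Finset.sum_congr rfl fun a _ => ?_
    rw [← Finset.sum_neg_distrib]
    exact Finset.sum_congr rfl fun b _ => by rw [E.extC_symm]; ring
  linarith

/-- On `X`, the function `λ (1 - P^R) f` is `(M_λ - C) (f - f^Δ)`. -/
theorem extLam_mul_idSubPR_some [DecidableEq X] [Nonempty X] (f : Option X → ℝ) (x : X) :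
    E.extLam (some x) * E.idSubPR f (some x) =
      ((Matrix.diagonal E.lam - Matrix.of E.C) *ᵥ fun y => f (some y) - f none) x := by
  rw [E.extLam_mul_idSubPR, Fintype.sum_option, Matrix.sub_mulVec, Pi.sub_apply,
    Matrix.mulVec_diagonal]
  simp only [extC, Matrix.mulVec, dotProduct, Matrix.of_apply, lam, totalMass, add_mul,
    Finset.sum_mul]
  rw [add_sub_assoc, ← Finset.sum_sub_distrib]
  congr 1
  exact Finset.sum_congr rfl fun y _ => by ring

variable [DecidableEq X]

/-- `G^R ν - (G^R ν)^Δ = G ν` on `X`. -/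
theorem recurrentGreen_sub [Nonempty X] {ν : Option X → ℝ} (hν : ∑ a, ν a = 0) (x : X) :
    E.recurrentGreen ν (some x) - E.recurrentGreen ν none =
      (E.green *ᵥ fun y => ν (some y)) x := by
  set A := Matrix.diagonal E.lam - Matrix.of E.C with hA
  have hu : IsUnit A.det := E.isUnit_diagonal_sub
  have hl := E.extLam_pos
  -- `Function.invFunOn` is meaningful only where a preimage exists. One is G ν on X extended by 0
  -- at Δ, minus its λ-mean c.
  have hex : ∃ f ∈ {f : Option X → ℝ | ∑ x, E.extLam x * f x = 0},
      E.idSubPR f = fun x => ν x / E.extLam x := by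
    set f₀ : Option X → ℝ := fun a => a.elim 0 (E.green *ᵥ fun y => ν (some y)) with hf₀
    set c := (∑ x, E.extLam x * f₀ x) / ∑ x, E.extLam x with hc
    have hL : 0 < ∑ x, E.extLam x := Finset.sum_pos (fun x _ => hl x) Finset.univ_nonempty
    set f : Option X → ℝ := fun a => f₀ a - c with hf
    have key : ∀ y, E.extLam (some y) * E.idSubPR f (some y) = ν (some y) := by
      intro y
      rw [E.extLam_mul_idSubPR_some]
      have : (fun y => f (some y) - f none) = E.green *ᵥ fun y => ν (some y) := by
        ext y
        simp [hf, hf₀]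
      rw [this, Matrix.mulVec_mulVec, green, Matrix.mul_nonsing_inv _ hu, Matrix.one_mulVec]
    refine ⟨f, ?_, ?_⟩
    · simp only [Set.mem_ofPred_eq, hf, mul_sub, Finset.sum_sub_distrib, ← Finset.sum_mul]
      rw [hc]
      field_simp
      ring
    · ext a
      rw [eq_div_iff (hl a).ne', mul_comm]
      cases a with
      | some y => exact key y
      -- At Δ the equation follows from those on X, because both sides have total charge zero.
      | none =>
        have h1 := E.sum_extLam_mul_idSubPR f
        rw [Fintype.sum_option] at h1 hν
        simp only [key] at h1
        linarith
  -- Only the equation is retained: additive constants disappear in the differences with the value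
  -- at Δ.
  have h := Function.invFunOn_eq hex
  have h' : ∀ a, E.extLam a * E.idSubPR (E.recurrentGreen ν) a = ν a := by
    intro a
    have := congrFun h a
    change E.idSubPR (E.recurrentGreen ν) a = _ at this
    rw [this, mul_div_cancel₀ _ (hl a).ne']
  have h2 : A *ᵥ (fun y => E.recurrentGreen ν (some y) - E.recurrentGreen ν none) =
      fun y => ν (some y) := by
    ext y
    rw [← E.extLam_mul_idSubPR_some, h']
  rw [← h2, Matrix.mulVec_mulVec, green, Matrix.nonsing_inv_mul _ hu, Matrix.one_mulVec]

theorem green_symm (x y : X) : E.green x y = E.green y x := by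
  have : (Matrix.diagonal E.lam - Matrix.of E.C)ᵀ = Matrix.diagonal E.lam - Matrix.of E.C := by
    rw [Matrix.transpose_sub, Matrix.diagonal_transpose]
    congr 1
    ext x y
    exact E.C_symm y x
  have h := Matrix.transpose_nonsing_inv (Matrix.diagonal E.lam - Matrix.of E.C)
  rw [this] at h
  exact congrFun (congrFun h y) x

/-- Subtracting the value at Δ is what allows the charge at Δ to be dropped from the dipole. -/
theorem dotProduct_dipole (F : Option X → ℝ) (η : Option X × Option X) :
    F η.1 - F η.2 = ∑ x, (F (some x) - F none) * dipole η x := by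
  have h : ∀ a : Option X, ∑ x, (F (some x) - F none) * (Pi.single a 1 : Option X → ℝ) (some x) =
      F a - F none := by
    intro a
    cases a with
    | none => simp
    | some y => simp [Pi.single_apply]
  simp only [dipole, Pi.sub_apply, mul_sub, Finset.sum_sub_distrib]
  simp only [h]
  ring

theorem transfer_eq [Nonempty X] (ξ η : Option X × Option X) :
    E.transfer ξ η = ∑ x, ∑ y, dipole ξ x * E.green x y * dipole η y := by
  rw [transfer, dotProduct_dipole (E.recurrentGreen _), Finset.sum_comm]
  have hν : ∑ a, (Pi.single ξ.1 1 - Pi.single ξ.2 1 : Option X → ℝ) a = 0 := by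
    simp [Pi.single_apply]
  refine Finset.sum_congr rfl fun y _ => ?_
  rw [E.recurrentGreen_sub hν, Matrix.mulVec, dotProduct, Finset.sum_mul]
  exact Finset.sum_congr rfl fun x _ => by rw [E.green_symm]; simp only [dipole]; ring

/-- The incidence matrix of the oriented links. -/
def incidence (o : Link X → Option X × Option X) : Matrix (Link X) X ℝ :=
  Matrix.of fun ξ x => dipole (o ξ) x

/-- The product of the values at `x` and `y` of a dipole, on a non oriented pair. -/
def dipoleSq (x y : X) : Sym2 (Option X) → ℝ :=
  Sym2.lift ⟨fun a b => dipole (a, b) x * dipole (a, b) y, fun a b => dipole_mul_dipole a b x y⟩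

/-- Twice the sum over links is the sum over ordered pairs, when the summand vanishes on the
diagonal. -/
theorem two_mul_sum_link {V : Type*} [Fintype V] [DecidableEq V] (F : Sym2 V → ℝ)
    (hF : ∀ a, F s(a, a) = 0) :
    2 * ∑ ξ : {ξ : Sym2 V // ¬ ξ.IsDiag}, F ξ = ∑ a, ∑ b, F s(a, b) := by
  rw [← Fintype.sum_prod_type', ← Finset.sum_fiberwise Finset.univ
    (fun p : V × V => s(p.1, p.2)) fun p => F s(p.1, p.2)]
  have h : ∀ z : Sym2 V, ∑ p : V × V with s(p.1, p.2) = z, F s(p.1, p.2) =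
      if ¬ z.IsDiag then 2 * F z else 0 := by
    intro z
    rw [Finset.sum_congr rfl (g := fun _ => F z) fun p hp => by rw [(Finset.mem_filter.1 hp).2],
      Finset.sum_const, nsmul_eq_mul]
    induction z with
    | h a b =>
      by_cases hab : a = b
      · subst hab
        simp [hF]
      · have : (Finset.univ.filter fun p : V × V => s(p.1, p.2) = s(a, b)) = {(a, b), (b, a)} := by
          ext ⟨c, d⟩
          simp
        rw [this, Finset.card_pair (by simp [hab])]
        simp [hab]
  simp only [h]
  rw [Finset.mul_sum, ← Finset.sum_filter]
  exact (Finset.sum_subtype (Finset.univ.filter fun z : Sym2 V => ¬ z.IsDiag) (by simp)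
    fun z => 2 * F z).symm

/-- The left side is a Laplacian with Dirichlet condition at Δ and conductances Tg. Its diagonal
entry at x is the sum of Tg over the links at x, which vanishes by the choice of Tg({x,Δ}); off the
diagonal remain the entries -Tg({x,y}). Products of two dipole values do not depend on the
orientation. -/
theorem incidence_mul (g : Sym2 (Option X) → ℝ) {o : Link X → Option X × Option X}
    (ho : IsOrientation o) :
    (incidence o)ᵀ * E.multTilt g * incidence o = -E.perturbation g := by
  ext x y
  have e1 : ((incidence o)ᵀ * E.multTilt g * incidence o) x y =
      ∑ ξ : Link X, E.tilt g ξ * dipoleSq x y ξ := by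
    rw [Matrix.mul_apply]
    refine Finset.sum_congr rfl fun ξ _ => ?_
    simp only [multTilt, Matrix.mul_diagonal, Matrix.transpose_apply, incidence, Matrix.of_apply]
    rw [← ho ξ]
    simp only [dipoleSq, Sym2.lift_mk]
    ring
  have e2 := two_mul_sum_link (fun ξ => E.tilt g ξ * dipoleSq x y ξ) (fun a => by
    simp [dipoleSq, dipole])
  have e3 : ∑ a, ∑ b, E.tilt g s(a, b) * dipoleSq x y s(a, b) = -2 * E.perturbation g x y := by
    set W : X → X → ℝ := fun a b => E.C a b * (1 - Real.exp (-g s(some a, some b))) with hW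
    have hWs : ∀ a b, W a b = W b a := fun a b => by
      simp only [hW]
      rw [E.C_symm, Sym2.eq_swap]
    have t1 : ∀ a b : X, E.tilt g s(some a, some b) = W a b := fun a b => rfl
    have t2 : ∀ a : X, E.tilt g s(some a, none) = -∑ z, W a z := fun a => by
      simp only [tilt, Sym2.lift_mk, tiltAux, hW, ← Finset.sum_neg_distrib]
      exact Finset.sum_congr rfl fun z _ => by ring
    have t3 : ∀ a : X, E.tilt g s(none, some a) = -∑ z, W a z := fun a => by
      rw [Sym2.eq_swap, t2]
    have s1 : ∑ a, ∑ b, W a b * dipoleSq x y s(some a, some b) =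
        2 * (if x = y then ∑ z, W x z else 0) - 2 * W x y := by
      -- Expansion of (δ_a - δ_b)(x) (δ_a - δ_b)(y): two diagonal terms and two cross terms.
      have r1 : ∑ a, ∑ b, W a b * dipoleSq x y s(some a, some b) =
          ∑ a, ∑ b, W a b * ((if x = a then 1 else 0) * (if y = a then 1 else 0)) +
          ∑ a, ∑ b, W a b * ((if x = b then 1 else 0) * (if y = b then 1 else 0)) -
          (∑ a, ∑ b, W a b * ((if x = a then 1 else 0) * (if y = b then 1 else 0)) +
          ∑ a, ∑ b, W a b * ((if x = b then 1 else 0) * (if y = a then 1 else 0))) := by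
        simp only [← Finset.sum_add_distrib, ← Finset.sum_sub_distrib]
        refine Finset.sum_congr rfl fun a _ => Finset.sum_congr rfl fun b _ => ?_
        simp only [dipoleSq, Sym2.lift_mk, dipole, Pi.sub_apply, Pi.single_apply,
          Option.some.injEq]
        ring
      have r2 : ∑ a, ∑ b, W a b * ((if x = a then 1 else 0) * (if y = a then 1 else 0)) =
          if x = y then ∑ z, W x z else 0 := by
        simp only [← Finset.sum_mul]
        rw [Finset.sum_eq_single x (by simp +contextual [eq_comm]) (by simp)]
        simp [eq_comm]
      have r3 : ∑ a, ∑ b, W a b * ((if x = b then 1 else 0) * (if y = b then 1 else 0)) =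
          if x = y then ∑ z, W x z else 0 := by
        rw [Finset.sum_comm, ← r2]
        exact Finset.sum_congr rfl fun a _ => Finset.sum_congr rfl fun b _ => by rw [hWs]
      have r4 : ∑ a, ∑ b, W a b * ((if x = a then 1 else 0) * (if y = b then 1 else 0)) =
          W x y := by
        rw [Finset.sum_eq_single x (by simp +contextual [eq_comm]) (by simp)]
        simp
      have r5 : ∑ a, ∑ b, W a b * ((if x = b then 1 else 0) * (if y = a then 1 else 0)) =
          W x y := by
        rw [Finset.sum_comm, ← r4]
        exact Finset.sum_congr rfl fun a _ => Finset.sum_congr rfl fun b _ => by rw [hWs]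
      rw [r1, r2, r3, r4, r5]
      ring
    have s2 : ∀ a : X, dipoleSq x y s(some a, none) =
        (if x = a then 1 else 0) * (if y = a then 1 else 0) := fun a => by
      simp [dipoleSq, dipole, Pi.single_apply]
    have s3 : ∀ a : X, dipoleSq x y s(none, some a) =
        (if x = a then 1 else 0) * (if y = a then 1 else 0) := fun a => by
      rw [Sym2.eq_swap, s2]
    have s4 : dipoleSq x y s((none : Option X), none) = 0 := by simp [dipoleSq, dipole]
    -- This contribution of the links to Δ occurs once for each order of the pair and cancels the
    -- diagonal part of `s1`.
    have s5 : ∑ a, -(∑ z, W a z) * ((if x = a then 1 else 0) * (if y = a then 1 else 0)) =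
        -if x = y then ∑ z, W x z else 0 := by
      rw [Finset.sum_eq_single x (by simp +contextual [eq_comm]) (by simp)]
      by_cases h : x = y <;> simp [h, eq_comm]
    simp only [Fintype.sum_option, t1, t2, t3, s2, s3, s4, s5, Finset.sum_add_distrib, s1]
    change _ = -2 * W x y
    ring
  rw [e1, Matrix.neg_apply]
  linarith

/-- The factorisation K = B G Bᵀ lets Sylvester's identity pass from a determinant over links to one
over points. -/
theorem det_one_sub_transferMatrix_mul [Nonempty X] (g : Sym2 (Option X) → ℝ)
    {o : Link X → Option X × Option X} (ho : IsOrientation o) :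
    (1 - E.transferMatrix o * E.multTilt g).det = (1 + E.green * E.perturbation g).det := by
  have hK : E.transferMatrix o = incidence o * (E.green * (incidence o)ᵀ) := by
    ext ξ η
    simp only [transferMatrix, Matrix.of_apply, E.transfer_eq, Matrix.mul_apply, incidence,
      Matrix.transpose_apply, Finset.mul_sum, mul_assoc]
  rw [hK, Matrix.mul_assoc, Matrix.det_one_sub_mul_comm, Matrix.mul_assoc E.green,
    Matrix.mul_assoc E.green, E.incidence_mul g ho, Matrix.mul_neg, sub_neg_eq_add]

end EnergyForm

/-! ### The loop measure -/

/-- The sum of the weights of the closed paths whose last step has weight `B`. -/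
theorem sum_prod_path_mul {X : Type*} [Fintype X] [DecidableEq X] (A : Matrix X X ℝ) (m : ℕ) :
    ∀ B : Matrix X X ℝ, ∑ ξ : Fin (m + 1) → X,
      (∏ i : Fin m, A (ξ i.castSucc) (ξ i.succ)) * B (ξ (Fin.last m)) (ξ 0) =
        (A ^ m * B).trace := by
  induction m with
  | zero =>
    intro B
    rw [← (Equiv.funUnique (Fin 1) X).symm.sum_comp]
    simp [Matrix.trace]
  | succ m ih =>
    intro B
    -- The last point is summed out and its incoming step absorbed into the closing weight; this is
    -- why B is arbitrary in the induction.
    rw [pow_succ, Matrix.mul_assoc, ← ih (A * B),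
      ← (Fin.snocEquiv fun _ : Fin (m + 2) => X).sum_comp, Fintype.sum_prod_type_right]
    refine Finset.sum_congr rfl fun ξ _ => ?_
    rw [Matrix.mul_apply, Finset.mul_sum]
    refine Finset.sum_congr rfl fun z _ => ?_
    have h0 : (Fin.snoc ξ z : Fin (m + 2) → X) 0 = ξ 0 := Fin.snoc_castSucc (i := (0 : Fin (m + 1))) ..
    rw [Fin.prod_univ_castSucc]
    simp only [Fin.snocEquiv_apply, Fin.succ_last, Fin.snoc_last, h0]
    simp only [← Fin.castSucc_succ, Fin.snoc_castSucc]
    ring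

/-- The sum of the weights of the closed paths of length `n + 1` is a trace. -/
theorem sum_prod_cyclic {X : Type*} [Fintype X] [DecidableEq X] (A : Matrix X X ℝ) (n : ℕ) :
    ∑ ξ : Fin (n + 1) → X, ∏ i, A (ξ i) (ξ (i + 1)) = (A ^ (n + 1)).trace := by
  rw [pow_succ, ← sum_prod_path_mul]
  refine Finset.sum_congr rfl fun ξ _ => ?_
  rw [Fin.prod_univ_castSucc, Fin.last_add_one]
  simp only [Fin.coeSucc_eq_succ]

/-! ### Integrals over the durations of the stays. -/

theorem lintegral_exp_neg_mul_Ioi {c : ℝ} (hc : 0 < c) :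
    ∫⁻ t in Set.Ioi (0 : ℝ), ENNReal.ofReal (Real.exp (-(c * t))) = ENNReal.ofReal c⁻¹ := by
  have h := integral_exp_mul_Ioi (neg_lt_zero.2 hc) 0
  have h' := integrableOn_exp_mul_Ioi (neg_lt_zero.2 hc) 0
  simp only [neg_mul] at h h'
  rw [← ofReal_integral_eq_lintegral_ofReal h' (Filter.Eventually.of_forall fun _ => by positivity),
    h]
  simp

theorem lintegral_inv_one_add_pow_Ioi (n : ℕ) :
    ∫⁻ u in Set.Ioi (0 : ℝ), ENNReal.ofReal (((1 + u)⁻¹) ^ (n + 2)) =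
      ENNReal.ofReal (1 / (n + 1)) := by
  have hd : ∀ u ∈ Set.Ici (0 : ℝ),
      HasDerivAt (fun u : ℝ => -((1 + u)⁻¹ ^ (n + 1) / (n + 1))) ((1 + u)⁻¹ ^ (n + 2)) u := by
    intro u hu
    have hu : 0 < 1 + u := by linarith [Set.mem_Ici.1 hu]
    have h1 : HasDerivAt (fun u : ℝ => 1 + u) 1 u := (hasDerivAt_id u).const_add 1
    refine (((h1.inv hu.ne').pow (n + 1)).div_const ((n : ℝ) + 1)).neg.congr_deriv ?_
    have : (n : ℝ) + 1 ≠ 0 := by positivity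
    push_cast
    simp only [Pi.inv_apply, inv_pow]
    field_simp
    ring
  have ht : Filter.Tendsto (fun u : ℝ => -((1 + u)⁻¹ ^ (n + 1) / (n + 1))) Filter.atTop
      (nhds 0) := by
    have h1 : Filter.Tendsto (fun u : ℝ => (1 + u)⁻¹) Filter.atTop (nhds 0) :=
      tendsto_inv_atTop_zero.comp (Filter.tendsto_atTop_add_const_left _ _ Filter.tendsto_id)
    simpa using ((h1.pow (n + 1)).div_const ((n : ℝ) + 1)).neg
  have hpos : ∀ u ∈ Set.Ioi (0 : ℝ), 0 ≤ (1 + u)⁻¹ ^ (n + 2) := fun u hu => by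
    have : 0 < u := hu
    positivity
  have hi := integrableOn_Ioi_deriv_of_nonneg' hd hpos ht
  rw [← ofReal_integral_eq_lintegral_ofReal hi
    ((ae_restrict_iff' measurableSet_Ioi).2 (Filter.Eventually.of_forall hpos)),
    integral_Ioi_of_hasDerivAt_of_nonneg' hd hpos ht]
  simp

theorem lintegral_exp_neg_mul_sum {m : ℕ} {c : ℝ} (hc : 0 < c) :
    ∫⁻ τ in {τ : Fin m → ℝ | ∀ i, 0 < τ i}, ENNReal.ofReal (Real.exp (-(c * ∑ i, τ i))) =
      ENNReal.ofReal (c⁻¹ ^ m) := by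
  have hset : {τ : Fin m → ℝ | ∀ i, 0 < τ i} = Set.univ.pi fun _ => Set.Ioi 0 := by
    ext τ
    simp
  have hint : Integrable (fun t : ℝ => Real.exp (-(c * t))) (volume.restrict (Set.Ioi 0)) := by
    have h' := integrableOn_exp_mul_Ioi (neg_lt_zero.2 hc) 0
    simp only [neg_mul] at h'
    exact h'
  have hval : ∫ t in Set.Ioi (0 : ℝ), Real.exp (-(c * t)) = c⁻¹ := by
    have h := integral_exp_mul_Ioi (neg_lt_zero.2 hc) 0
    simp only [neg_mul] at h
    rw [h]
    simp
  have hprod : ∀ τ : Fin m → ℝ, Real.exp (-(c * ∑ i, τ i)) = ∏ i, Real.exp (-(c * τ i)) := by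
    intro τ
    rw [← Real.exp_sum, Finset.sum_neg_distrib, Finset.mul_sum]
  rw [hset, volume_pi, Measure.restrict_pi_pi]
  simp only [hprod]
  rw [← ofReal_integral_eq_lintegral_ofReal
    (Integrable.fintype_prod (f := fun _ t => Real.exp (-(c * t))) fun _ => hint)
    (Filter.Eventually.of_forall fun _ => by positivity),
    integral_fintype_prod_eq_prod (f := fun _ t => Real.exp (-(c * t)))]
  simp [hval]

/-- The durations of the stays of loops with `n + 2` points have total mass `1 / (n + 2)`. -/
theorem lintegral_stays (n : ℕ) :
    ∫⁻ τ in {τ : Fin (n + 3) → ℝ | ∀ i, 0 < τ i},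
      ENNReal.ofReal (Real.exp (-∑ i, τ i) / ∑ i, τ i) = ENNReal.ofReal (1 / (n + 2)) := by
  have hm : MeasurableSet {τ : Fin (n + 3) → ℝ | ∀ i, 0 < τ i} := by
    rw [show {τ : Fin (n + 3) → ℝ | ∀ i, 0 < τ i} = Set.univ.pi fun _ => Set.Ioi 0 by ext; simp]
    exact MeasurableSet.univ_pi fun _ => measurableSet_Ioi
  -- The factor 1/s, with s the total time, is written as the integral of e^{-us} over u > 0. After
  -- Tonelli the n + 3 durations are independent exponentials of rate 1 + u, leaving ∫ (1 +
  -- u)^{-(n+3)} du.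
  calc _ = ∫⁻ τ in {τ : Fin (n + 3) → ℝ | ∀ i, 0 < τ i}, ∫⁻ u in Set.Ioi (0 : ℝ),
        ENNReal.ofReal (Real.exp (-((1 + u) * ∑ i, τ i))) := by
        refine setLIntegral_congr_fun hm fun τ hτ => ?_
        have hs : 0 < ∑ i, τ i := Finset.sum_pos (fun i _ => hτ i) Finset.univ_nonempty
        have : ∀ u : ℝ, ENNReal.ofReal (Real.exp (-((1 + u) * ∑ i, τ i))) =
            ENNReal.ofReal (Real.exp (-∑ i, τ i)) *
              ENNReal.ofReal (Real.exp (-((∑ i, τ i) * u))) := by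
          intro u
          rw [← ENNReal.ofReal_mul (Real.exp_pos _).le, ← Real.exp_add]
          congr 2
          ring
        simp only [this]
        rw [lintegral_const_mul _ (by fun_prop), lintegral_exp_neg_mul_Ioi hs,
          ← ENNReal.ofReal_mul (Real.exp_pos _).le, div_eq_mul_inv]
    _ = ∫⁻ u in Set.Ioi (0 : ℝ), ∫⁻ τ in {τ : Fin (n + 3) → ℝ | ∀ i, 0 < τ i},
        ENNReal.ofReal (Real.exp (-((1 + u) * ∑ i, τ i))) :=
        lintegral_lintegral_swap (by fun_prop)
    _ = ∫⁻ u in Set.Ioi (0 : ℝ), ENNReal.ofReal (((1 + u)⁻¹) ^ (n + 1 + 2)) := by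
        refine setLIntegral_congr_fun measurableSet_Ioi fun u hu => ?_
        exact lintegral_exp_neg_mul_sum (by linarith [Set.mem_Ioi.1 hu])
    _ = _ := by
        rw [lintegral_inv_one_add_pow_Ioi]
        push_cast
        congr 2
        ring

/-! ### Step counts and their measurability. -/

section

variable {X : Type*} [DecidableEq X]

/-- The numbers of steps of a loop, as a function of the ordered pair of points. -/
def crossingVector (l : Loop X) (x y : X) : ℕ := crossings x y l

/-- The numbers of steps of a cyclic sequence of points. -/
def stepVector {n : ℕ} (ξ : Fin (n + 2) → X) (x y : X) : ℕ :=
  (Finset.univ.filter fun i => ξ i = x ∧ ξ (i + 1) = y).card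

theorem sum_mul_stepVector [Fintype X] {n : ℕ} (ξ : Fin (n + 2) → X) (f : X → X → ℝ) :
    ∑ x, ∑ y, f x y * stepVector ξ x y = ∑ i, f (ξ i) (ξ (i + 1)) := by
  simp only [stepVector, Finset.card_filter, Nat.cast_sum, Finset.mul_sum]
  rw [Finset.sum_congr rfl fun x _ => Finset.sum_comm, Finset.sum_comm]
  refine Finset.sum_congr rfl fun i _ => ?_
  rw [Finset.sum_eq_single (ξ i), Finset.sum_eq_single (ξ (i + 1))]
  · simp
  · intro y _ hy
    simp [hy.symm]
  · simp
  · intro x _ hx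
    simp [hx.symm]
  · simp

theorem stepVector_le {n : ℕ} (ξ : Fin (n + 2) → X) (x y : X) : stepVector ξ x y ≤ n + 2 :=
  (Finset.card_filter_le _ _).trans (by simp)

theorem measurable_sigma_mk' {ι : Type*} {β : ι → Type*} [∀ i, MeasurableSpace (β i)] (i : ι) :
    Measurable (Sigma.mk i : β i → Σ i, β i) :=
  fun _ hs => (MeasurableSpace.measurableSet_iInf.1 hs i)

theorem measurable_of_sigma {ι γ : Type*} {β : ι → Type*} [∀ i, MeasurableSpace (β i)]
    [MeasurableSpace γ] {f : (Σ i, β i) → γ} (h : ∀ i, Measurable fun b => f ⟨i, b⟩) :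
    Measurable f :=
  fun _ hs => MeasurableSpace.measurableSet_iInf.2 fun i => h i hs

variable [Finite X] [MeasurableSpace X] [MeasurableSingletonClass X]

theorem measurable_crossingVector : Measurable (crossingVector (X := X)) := by
  refine measurable_pi_lambda _ fun x => measurable_pi_lambda _ fun y => ?_
  refine measurable_from_quotient.2 ?_
  refine measurable_fun_sum (f := basedCrossings x y) measurable_const ?_
  refine measurable_of_sigma fun n => ?_
  exact (measurable_of_countable fun ξ : Fin (n + 2) → X => stepVector ξ x y).comp measurable_fst

end

/-! ### Step counts under the loop measure. -/

namespace EnergyForm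

variable {X : Type*} [Fintype X] (E : EnergyForm X)

theorem P_nonneg (x y : X) : 0 ≤ E.P x y := div_nonneg (E.C_nonneg x y) (E.lam_pos' x).le

variable [DecidableEq X]

theorem sum_prod_P_mul (w : X → X → ℝ) (n : ℕ) :
    ∑ ξ : Fin (n + 2) → X, (∏ i, E.P (ξ i) (ξ (i + 1))) * ∏ i, w (ξ i) (ξ (i + 1)) =
      (E.weighted w ^ (n + 2)).trace := by
  rw [← sum_prod_cyclic]
  simp only [weighted, Matrix.of_apply, Finset.prod_mul_distrib]

variable [MeasurableSpace X] [MeasurableSingletonClass X]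

/-- The image of the loop measure by the numbers of steps. -/
theorem lintegral_crossingVector (F : (X → X → ℕ) → ℝ≥0∞) (hF : F 0 = 0) :
    ∫⁻ l, F (crossingVector l) ∂E.loopMeasure = ∑' n : ℕ, ∑ ξ : Fin (n + 2) → X,
      ENNReal.ofReal (∏ i, E.P (ξ i) (ξ (i + 1))) *
        (ENNReal.ofReal (1 / (n + 2)) * F (stepVector ξ)) := by
  have hFm : Measurable F := measurable_of_countable F
  have hq : Measurable (Quotient.mk (shiftSetoid X)) := measurable_quotient_mk'
  have hm : Measurable fun l : Loop X => F (crossingVector l) := hFm.comp measurable_crossingVector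
  have hmb : Measurable fun a : BasedLoop X => F (crossingVector (Quotient.mk (shiftSetoid X) a)) :=
    hm.comp hq
  rw [loopMeasure, lintegral_map hm hq, basedLoopMeasure, lintegral_add_measure,
    lintegral_finsetSum_measure, lintegral_sum_measure]
  -- Trivial loops have infinite mass, as e^{-t}/t is not integrable at 0, but their step counts
  -- vanish and F 0 = 0 removes them.
  have h1 : ∀ x : X, ∫⁻ a, F (crossingVector (Quotient.mk (shiftSetoid X) a))
      ∂(((volume : Measure ℝ).restrict (Set.Ioi 0)).withDensity
      fun t => ENNReal.ofReal (Real.exp (-t) / t)).map (fun t => (Sum.inl (x, t) : BasedLoop X)) =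
        0 := by
    intro x
    have hmk : Measurable fun t : ℝ => (Sum.inl (x, t) : BasedLoop X) :=
      measurable_inl.comp measurable_prodMk_left
    rw [lintegral_map hmb hmk]
    exact (lintegral_congr fun t => hF).trans lintegral_zero
  rw [Finset.sum_congr rfl fun x _ => h1 x, Finset.sum_const_zero, zero_add, ENNReal.tsum_sigma']
  refine tsum_congr fun n => ?_
  rw [tsum_fintype]
  refine Finset.sum_congr rfl fun ξ _ => ?_
  have hmk : Measurable fun τ : Fin (n + 3) → ℝ => (Sum.inr ⟨n, ξ, τ⟩ : BasedLoop X) :=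
    measurable_inr.comp ((measurable_sigma_mk' n).comp measurable_prodMk_left)
  rw [lintegral_smul_measure, lintegral_map hmb hmk, smul_eq_mul]
  congr 1
  have hc : ∀ τ : Fin (n + 3) → ℝ, F (crossingVector (Quotient.mk (shiftSetoid X)
      (Sum.inr ⟨n, ξ, τ⟩))) = F (stepVector ξ) := fun τ => rfl
  rw [lintegral_congr hc, lintegral_const, withDensity_apply _ MeasurableSet.univ,
    Measure.restrict_univ, lintegral_stays, mul_comm]

/-- A loop with n + 2 points makes at most n + 2 such steps, which cancels the factor 1/(n + 2); the
convergent series of the traces of P^{n+2} remains. -/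
theorem lintegral_crossings_lt_top (x y : X) :
    ∫⁻ l, (crossings x y l : ℝ≥0∞) ∂E.loopMeasure < ⊤ := by
  have h := E.lintegral_crossingVector (fun c => (c x y : ℝ≥0∞)) (by simp)
  have hs := (E.log_det_one_sub_weighted (w := fun _ _ => 1) (fun _ _ => rfl)
    (fun _ _ => zero_le_one) fun _ _ => le_rfl).2.2
  refine lt_of_le_of_lt (h.trans_le (ENNReal.tsum_le_tsum (g := fun n : ℕ =>
    ENNReal.ofReal ((E.weighted (fun _ _ => 1) ^ (n + 2)).trace)) fun n => ?_)) ?_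
  · rw [← E.sum_prod_P_mul]
    simp only [Finset.prod_const_one, mul_one]
    rw [ENNReal.ofReal_sum_of_nonneg fun ξ _ => Finset.prod_nonneg fun i _ => E.P_nonneg _ _]
    refine Finset.sum_le_sum fun ξ _ => ?_
    refine mul_le_of_le_one_right' ?_
    rw [← ENNReal.ofReal_natCast, ← ENNReal.ofReal_mul (by positivity), ENNReal.ofReal_le_one,
      div_mul_eq_mul_div, one_mul, div_le_one (by positivity)]
    exact_mod_cast stepVector_le ξ x y
  · exact hs.tsum_ofReal_lt_top

/-- Any cyclic sequence using the step from x to y contains the factor `E.P x y`, which is zero. -/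
theorem lintegral_crossings_eq_zero {x y : X} (hxy : E.C x y = 0) :
    ∫⁻ l, (crossings x y l : ℝ≥0∞) ∂E.loopMeasure = 0 := by
  refine (E.lintegral_crossingVector (fun c => (c x y : ℝ≥0∞)) (by simp)).trans ?_
  refine ENNReal.tsum_eq_zero.2 fun n => Finset.sum_eq_zero fun ξ _ => ?_
  by_cases h : stepVector ξ x y = 0
  · simp [h]
  · obtain ⟨i, hi⟩ := Finset.card_ne_zero.1 h
    obtain ⟨h1, h2⟩ := (Finset.mem_filter.1 hi).2
    rw [Finset.prod_eq_zero (Finset.mem_univ i) (by rw [h1, h2, P, hxy, zero_div])]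
    simp

/-- `∫ (1 - e^{-∑ f N}) dμ = log det (1 - P e^{-f}) - log det (1 - P)`. -/
theorem lintegral_one_sub_exp (f : X → X → ℝ) (hf : ∀ x y, 0 ≤ f x y)
    (hsymm : ∀ x y, f x y = f y x) :
    0 ≤ Real.log (1 - E.weighted fun x y => Real.exp (-f x y)).det -
      Real.log (1 - E.weighted fun _ _ => 1).det ∧
    ∫⁻ l, ENNReal.ofReal (1 - Real.exp (-∑ x, ∑ y, f x y * crossings x y l)) ∂E.loopMeasure =
      ENNReal.ofReal (Real.log (1 - E.weighted fun x y => Real.exp (-f x y)).det -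
        Real.log (1 - E.weighted fun _ _ => 1).det) := by
  have hI := (E.lintegral_crossingVector
    (fun c => ENNReal.ofReal (1 - Real.exp (-∑ x, ∑ y, f x y * c x y))) (by simp))
  obtain ⟨-, h1, -⟩ := E.log_det_one_sub_weighted (w := fun _ _ => 1) (fun _ _ => rfl)
    (fun _ _ => zero_le_one) fun _ _ => le_rfl
  obtain ⟨-, h2, -⟩ := E.log_det_one_sub_weighted (w := fun x y => Real.exp (-f x y))
    (fun x y => by rw [hsymm]) (fun _ _ => (Real.exp_pos _).le)
    fun x y => Real.exp_le_one_iff.2 (neg_nonpos.2 (hf x y))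
  have h3 := h1.sub h2
  have hterm : ∀ n : ℕ, ∑ ξ : Fin (n + 2) → X, ENNReal.ofReal (∏ i, E.P (ξ i) (ξ (i + 1))) *
      (ENNReal.ofReal (1 / (n + 2)) *
        ENNReal.ofReal (1 - Real.exp (-∑ x, ∑ y, f x y * stepVector ξ x y))) =
      ENNReal.ofReal ((E.weighted (fun _ _ => 1) ^ (n + 2)).trace / (n + 2) -
        (E.weighted (fun x y => Real.exp (-f x y)) ^ (n + 2)).trace / (n + 2)) ∧
      0 ≤ (E.weighted (fun _ _ => 1) ^ (n + 2)).trace / (n + 2) -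
        (E.weighted (fun x y => Real.exp (-f x y)) ^ (n + 2)).trace / (n + 2) := by
    intro n
    have hp : ∀ ξ : Fin (n + 2) → X, 0 ≤ ∏ i, E.P (ξ i) (ξ (i + 1)) := fun ξ =>
      Finset.prod_nonneg fun i _ => E.P_nonneg _ _
    have hexp : ∀ ξ : Fin (n + 2) → X, Real.exp (-∑ x, ∑ y, f x y * stepVector ξ x y) =
        ∏ i, Real.exp (-f (ξ i) (ξ (i + 1))) := fun ξ => by
      rw [sum_mul_stepVector, ← Real.exp_sum, Finset.sum_neg_distrib]
    have hle : ∀ ξ : Fin (n + 2) → X, 0 ≤ 1 - Real.exp (-∑ x, ∑ y, f x y * stepVector ξ x y) :=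
      fun ξ => sub_nonneg.2 (Real.exp_le_one_iff.2 (neg_nonpos.2 (Finset.sum_nonneg fun x _ =>
        Finset.sum_nonneg fun y _ => mul_nonneg (hf x y) (Nat.cast_nonneg _))))
    have hnn : ∀ ξ : Fin (n + 2) → X, 0 ≤ (∏ i, E.P (ξ i) (ξ (i + 1))) *
        (1 / (n + 2) * (1 - Real.exp (-∑ x, ∑ y, f x y * stepVector ξ x y))) := fun ξ =>
      mul_nonneg (hp ξ) (mul_nonneg (by positivity) (hle ξ))
    have heq : (E.weighted (fun _ _ => 1) ^ (n + 2)).trace / (n + 2) -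
        (E.weighted (fun x y => Real.exp (-f x y)) ^ (n + 2)).trace / (n + 2) =
        ∑ ξ : Fin (n + 2) → X, (∏ i, E.P (ξ i) (ξ (i + 1))) *
          (1 / (n + 2) * (1 - Real.exp (-∑ x, ∑ y, f x y * stepVector ξ x y))) := by
      rw [← E.sum_prod_P_mul, ← E.sum_prod_P_mul, Finset.sum_div, Finset.sum_div,
        ← Finset.sum_sub_distrib]
      refine Finset.sum_congr rfl fun ξ _ => ?_
      rw [hexp, Finset.prod_const_one]
      ring
    rw [heq]
    refine ⟨?_, Finset.sum_nonneg fun ξ _ => hnn ξ⟩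
    rw [ENNReal.ofReal_sum_of_nonneg fun ξ _ => hnn ξ]
    refine Finset.sum_congr rfl fun ξ _ => ?_
    rw [ENNReal.ofReal_mul (hp ξ), ENNReal.ofReal_mul (by positivity)]
  rw [tsum_congr fun n => (hterm n).1,
    ← ENNReal.ofReal_tsum_of_nonneg (fun n => (hterm n).2) h3.summable, h3.tsum_eq,
    neg_sub_neg] at hI
  exact ⟨neg_sub_neg (Real.log _) _ ▸ h3.nonneg fun n => (hterm n).2, hI⟩

end EnergyForm

/-! ### Poisson variables and Poisson point processes -/

open scoped NNReal Nat

theorem lintegral_natCast_poissonMeasure (r : ℝ≥0) :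
    ∫⁻ n, (n : ℝ≥0∞) ∂poissonMeasure r = r := by
  rw [lintegral_countable']
  have h : HasSum (fun n : ℕ => (n : ℝ) * (Real.exp (-r) * r ^ n / n !)) r := by
    -- The term n = 0 is zero, and n r^n / n! = r · r^{n-1} / (n-1)! reduces the rest to the total
    -- mass.
    refine (hasSum_nat_add_iff' 1).1 ?_
    have := (hasSum_one_poissonMeasure r).mul_left (r : ℝ)
    simp only [Finset.sum_range_one, Nat.cast_zero, zero_mul, sub_zero]
    rw [mul_one] at this
    refine this.congr_fun fun n => ?_
    rw [Nat.factorial_succ]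
    push_cast
    field_simp
    ring
  have hn : ∀ n : ℕ, 0 ≤ (n : ℝ) * (Real.exp (-r) * r ^ n / n !) := fun n => by positivity
  rw [← ENNReal.ofReal_coe_nnreal, ← h.tsum_eq, ENNReal.ofReal_tsum_of_nonneg hn h.summable]
  refine tsum_congr fun n => ?_
  rw [poissonMeasure_singleton, ENNReal.ofReal_mul (Nat.cast_nonneg _), ENNReal.ofReal_natCast]

theorem integral_exp_neg_mul_poissonMeasure (r : ℝ≥0) (t : ℝ) :
    ∫ n : ℕ, Real.exp (-(t * n)) ∂poissonMeasure r = Real.exp (-(r * (1 - Real.exp (-t)))) := by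
  rw [integral_poissonMeasure]
  have h := (NormedSpace.expSeries_div_hasSum_exp (r * Real.exp (-t) : ℝ)).mul_left (Real.exp (-r))
  rw [← Real.exp_eq_exp_ℝ, ← Real.exp_add] at h
  rw [show -(r * (1 - Real.exp (-t))) = -r + r * Real.exp (-t) by ring, ← h.tsum_eq]
  refine tsum_congr fun n => ?_
  rw [mul_pow, ← Real.exp_nat_mul, smul_eq_mul, mul_neg, mul_comm (n : ℝ) t]
  ring

/-! ### Mean measure and Laplace functional of a Poisson point process. -/

namespace IsPoissonPoint

variable {Ω S : Type*} [MeasurableSpace Ω] [MeasurableSpace S] {Pr : Measure Ω}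
  {L : Ω → Measure S} {ν : Measure S}

theorem measurable_apply (hL : IsPoissonPoint Pr L ν) {A : Set S} (hA : MeasurableSet A) :
    Measurable fun ω => L ω A :=
  (Measure.measurable_coe hA).comp hL.measurable

theorem lintegral_apply [IsProbabilityMeasure Pr] (hL : IsPoissonPoint Pr L ν) {A : Set S}
    (hA : MeasurableSet A) : ∫⁻ ω, L ω A ∂Pr = ν A := by
  by_cases h : ν A = ⊤
  · rw [h, lintegral_congr_ae (hL.law_top A hA h)]
    simp
  · have h1 : ∫⁻ ω, L ω A ∂Pr = ∫⁻ a, a ∂Pr.map fun ω => L ω A :=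
      (lintegral_map measurable_id (hL.measurable_apply hA)).symm
    rw [h1, hL.law A hA h, lintegral_map (f := fun a => a) measurable_id (measurable_of_countable _)]
    exact (lintegral_natCast_poissonMeasure _).trans (ENNReal.coe_toNNReal h)

/-- Campbell's formula. -/
theorem lintegral_lintegral [IsProbabilityMeasure Pr] (hL : IsPoissonPoint Pr L ν)
    {f : S → ℝ≥0∞} (hf : Measurable f) : ∫⁻ ω, ∫⁻ s, f s ∂L ω ∂Pr = ∫⁻ s, f s ∂ν := by
  rw [← Measure.lintegral_bind hL.measurable.aemeasurable hf.aemeasurable]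
  congr 1
  ext A hA
  rw [Measure.bind_apply hA hL.measurable.aemeasurable, hL.lintegral_apply hA]

theorem integral_exp_neg_mul (hL : IsPoissonPoint Pr L ν) {A : Set S}
    (hA : MeasurableSet A) (hν : ν A ≠ ⊤) (t : ℝ) :
    ∫ ω, Real.exp (-(t * (L ω A).toReal)) ∂Pr =
      Real.exp (-((ν A).toReal * (1 - Real.exp (-t)))) := by
  have hm : Measurable fun a : ℝ≥0∞ => Real.exp (-(t * a.toReal)) := by fun_prop
  have h1 : ∫ ω, Real.exp (-(t * (L ω A).toReal)) ∂Pr =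
      ∫ a, Real.exp (-(t * a.toReal)) ∂Pr.map fun ω => L ω A :=
    (integral_map (hL.measurable_apply hA).aemeasurable hm.aestronglyMeasurable).symm
  rw [h1, hL.law A hA hν, integral_map (measurable_of_countable _).aemeasurable
    hm.aestronglyMeasurable]
  exact integral_exp_neg_mul_poissonMeasure _ _

/-- The Laplace functional on finitely many disjoint sets. -/
theorem integral_exp_neg_sum [IsProbabilityMeasure Pr] (hL : IsPoissonPoint Pr L ν) {ι : Type*}
    {A : ι → Set S} (hA : ∀ i, MeasurableSet (A i)) (hd : Pairwise fun i j => Disjoint (A i) (A j))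
    {h : ι → ℝ} (hν : ∀ i, h i ≠ 0 → ν (A i) ≠ ⊤) (s : Finset ι) :
    ∫ ω, Real.exp (-∑ i ∈ s, h i * (L ω (A i)).toReal) ∂Pr =
      Real.exp (-∑ i ∈ s, (ν (A i)).toReal * (1 - Real.exp (-h i))) := by
  have hind : iIndepFun (fun (i : s) ω => L ω (A i)) Pr := by
    have h0 := hL.indep s.card (fun k => A (s.equivFin.symm k)) (fun k => hA _) fun i j hij =>
      hd fun h => hij (s.equivFin.symm.injective (Subtype.ext h))
    have h1 := h0.precomp s.equivFin.injective
    simpa only [Function.comp_def, Equiv.symm_apply_apply] using h1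
  have hind' : iIndepFun (fun (i : s) ω => h i * (L ω (A i)).toReal) Pr :=
    hind.comp (fun i a => h i * a.toReal) fun i => by fun_prop
  have hm := hind'.mgf_sum (t := -1) (fun i => (hL.measurable_apply (hA i)).ennreal_toReal.const_mul _)
    Finset.univ
  have e1 : mgf (∑ i : s, fun ω => h i * (L ω (A i)).toReal) Pr (-1) =
      ∫ ω, Real.exp (-∑ i ∈ s, h i * (L ω (A i)).toReal) ∂Pr := by
    simp only [mgf, Finset.sum_apply, neg_one_mul]
    refine integral_congr_ae (Filter.Eventually.of_forall fun ω => ?_)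
    simp only
    rw [← Finset.sum_coe_sort s fun i => h i * (L ω (A i)).toReal]
  rw [← e1, hm, ← Finset.sum_neg_distrib, Real.exp_sum, ← Finset.prod_coe_sort s]
  refine Finset.prod_congr rfl fun i _ => ?_
  simp only [mgf, neg_one_mul]
  -- If h i = 0, both factors are 1 even when the set has infinite intensity; for loops, this covers
  -- the class with no steps, which contains the trivial loops.
  by_cases hi : h i = 0
  · simp [hi]
  · exact hL.integral_exp_neg_mul (hA i) (hν i hi) _

/-- The Laplace functional of a Poisson point process, for a function of countably many values. -/
theorem integral_exp_neg_lintegral [IsProbabilityMeasure Pr] (hL : IsPoissonPoint Pr L ν)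
    {ι : Type*} [Countable ι] [MeasurableSpace ι] [MeasurableSingletonClass ι] {V : S → ι}
    (hV : Measurable V) {h : ι → ℝ} (h0 : ∀ i, 0 ≤ h i)
    (hfin : ∫⁻ s, ENNReal.ofReal (h (V s)) ∂ν ≠ ⊤) :
    ∫ ω, Real.exp (-(∫⁻ s, ENNReal.ofReal (h (V s)) ∂L ω).toReal) ∂Pr =
      Real.exp (-(∫⁻ s, ENNReal.ofReal (1 - Real.exp (-h (V s))) ∂ν).toReal) := by
  have hsum : ∀ (m : Measure S) (f : ι → ℝ), ∫⁻ s, ENNReal.ofReal (f (V s)) ∂m =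
      ∑' i, ENNReal.ofReal (f i) * m (V ⁻¹' {i}) := by
    intro m f
    have : Measurable fun i => ENNReal.ofReal (f i) := measurable_of_countable _
    rw [← lintegral_map this hV, lintegral_countable']
    exact tsum_congr fun i => by rw [Measure.map_apply hV (measurableSet_singleton i)]
  have hhas : ∀ (m : Measure S) (f : ι → ℝ), (∀ i, 0 ≤ f i) →
      ∫⁻ s, ENNReal.ofReal (f (V s)) ∂m ≠ ⊤ →
      HasSum (fun i => f i * (m (V ⁻¹' {i})).toReal)
        (∫⁻ s, ENNReal.ofReal (f (V s)) ∂m).toReal := by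
    intro m f hf hm
    rw [hsum] at hm ⊢
    rw [ENNReal.tsum_toReal_eq (ENNReal.ne_top_of_tsum_ne_top hm)]
    have := (ENNReal.summable_toReal hm).hasSum
    simpa only [ENNReal.toReal_mul, ENNReal.toReal_ofReal (hf _)] using this
  have hle : ∀ i, 0 ≤ 1 - Real.exp (-h i) := fun i =>
    sub_nonneg.2 (Real.exp_le_one_iff.2 (neg_nonpos.2 (h0 i)))
  have hfin' : ∫⁻ s, ENNReal.ofReal (1 - Real.exp (-h (V s))) ∂ν ≠ ⊤ := by
    refine ne_top_of_le_ne_top hfin (lintegral_mono fun s => ENNReal.ofReal_le_ofReal ?_)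
    linarith [Real.add_one_le_exp (-h (V s))]
  have hA : ∀ i, MeasurableSet (V ⁻¹' {i}) := fun i => hV (measurableSet_singleton i)
  have hν : ∀ i, h i ≠ 0 → ν (V ⁻¹' {i}) ≠ ⊤ := by
    intro i hi htop
    have h1 := hfin
    rw [hsum] at h1
    refine ENNReal.ne_top_of_tsum_ne_top h1 i ?_
    rw [htop, ENNReal.mul_top]
    exact (ENNReal.ofReal_pos.2 (lt_of_le_of_ne (h0 i) hi.symm)).ne'
  have hd : Pairwise fun i j => Disjoint (V ⁻¹' {i}) (V ⁻¹' {j}) := fun i j hij =>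
    Disjoint.preimage _ (Set.disjoint_singleton.2 hij)
  have hmeas : Measurable fun s => ENNReal.ofReal (h (V s)) :=
    (measurable_of_countable fun i => ENNReal.ofReal (h i)).comp hV
  -- By Campbell's formula the integral has finite mean, hence is almost surely finite.
  have hae : ∀ᵐ ω ∂Pr, ∫⁻ s, ENNReal.ofReal (h (V s)) ∂L ω < ⊤ :=
    ae_lt_top ((Measure.measurable_lintegral hmeas).comp hL.measurable)
      (by rwa [hL.lintegral_lintegral hmeas])
  -- The level sets of V are disjoint and countably many. The formula for finitely many of them
  -- passes to the limit by dominated convergence, the integrands being bounded by 1.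
  have hlim1 : Filter.Tendsto (fun s : Finset ι =>
      ∫ ω, Real.exp (-∑ i ∈ s, h i * (L ω (V ⁻¹' {i})).toReal) ∂Pr) Filter.atTop
      (nhds (∫ ω, Real.exp (-(∫⁻ s, ENNReal.ofReal (h (V s)) ∂L ω).toReal) ∂Pr)) := by
    refine tendsto_integral_filter_of_dominated_convergence (fun _ => 1) ?_ ?_
      (integrable_const _) ?_
    · refine Filter.Eventually.of_forall fun s => Measurable.aestronglyMeasurable ?_
      exact (Finset.measurable_fun_sum s fun i _ =>
        (hL.measurable_apply (hA i)).ennreal_toReal.const_mul (h i)).neg.exp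
    · refine Filter.Eventually.of_forall fun s => Filter.Eventually.of_forall fun ω => ?_
      rw [Real.norm_eq_abs, Real.abs_exp, Real.exp_le_one_iff, neg_nonpos]
      exact Finset.sum_nonneg fun i _ => mul_nonneg (h0 i) ENNReal.toReal_nonneg
    · filter_upwards [hae] with ω hω
      exact ((Real.continuous_exp.comp continuous_neg).tendsto _).comp (hhas (L ω) h h0 hω.ne)
  have hlim2 : Filter.Tendsto (fun s : Finset ι =>
      Real.exp (-∑ i ∈ s, (ν (V ⁻¹' {i})).toReal * (1 - Real.exp (-h i)))) Filter.atTop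
      (nhds (Real.exp (-(∫⁻ s, ENNReal.ofReal (1 - Real.exp (-h (V s))) ∂ν).toReal))) := by
    have := (hhas ν (fun i => 1 - Real.exp (-h i)) hle hfin').congr_fun fun i =>
      mul_comm ((ν (V ⁻¹' {i})).toReal) _
    exact ((Real.continuous_exp.comp continuous_neg).tendsto _).comp this
  simp only [hL.integral_exp_neg_sum hA hd hν] at hlim1
  exact tendsto_nhds_unique hlim1 hlim2

end IsPoissonPoint

/-! ### The two determinant formulas -/

theorem measurable_crossings {X : Type*} [Finite X] [DecidableEq X] [MeasurableSpace X]
    [MeasurableSingletonClass X] (x y : X) :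
    Measurable fun l : Loop X => (crossings x y l : ℝ≥0∞) :=
  (measurable_of_countable fun c : X → X → ℕ => (c x y : ℝ≥0∞)).comp measurable_crossingVector

namespace EnergyForm

variable {X : Type*} [Fintype X] (E : EnergyForm X)

/-- The function `g` on the links of `X`, extended by `0` to the other pairs. -/
def onLinks (g : Sym2 (Option X) → ℝ) (x y : X) : ℝ :=
  if E.C x y = 0 then 0 else g s(some x, some y)

theorem onLinks_symm (g : Sym2 (Option X) → ℝ) (x y : X) : E.onLinks g x y = E.onLinks g y x := by
  rw [onLinks, onLinks, E.C_symm, Sym2.eq_swap]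

theorem onLinks_nonneg {g : Sym2 (Option X) → ℝ}
    (hg : ∀ x y : X, 0 < E.C x y → 0 ≤ g s(some x, some y)) (x y : X) : 0 ≤ E.onLinks g x y := by
  rw [onLinks]
  split_ifs with h
  · exact le_rfl
  · exact hg x y (lt_of_le_of_ne (E.C_nonneg x y) (Ne.symm h))

/-- Off the links `E.P` vanishes, so the unconstrained values of g there do not matter. -/
theorem weighted_onLinks (g : Sym2 (Option X) → ℝ) :
    E.weighted (fun x y => Real.exp (-E.onLinks g x y)) =
      E.weighted fun x y => Real.exp (-g s(some x, some y)) := by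
  ext x y
  by_cases h : E.C x y = 0 <;> simp [weighted, onLinks, P, h]

variable [DecidableEq X]

theorem det_one_add_green_mul_perturbation_pos {g : Sym2 (Option X) → ℝ}
    (hg : ∀ x y : X, 0 < E.C x y → 0 ≤ g s(some x, some y)) :
    0 < (1 + E.green * E.perturbation g).det := by
  rw [E.det_one_add_green_mul_perturbation, ← E.weighted_onLinks]
  refine div_pos ?_ ?_
  · exact (E.log_det_one_sub_weighted (fun x y => by rw [E.onLinks_symm])
      (fun _ _ => (Real.exp_pos _).le)
      fun x y => Real.exp_le_one_iff.2 (neg_nonpos.2 (E.onLinks_nonneg hg x y))).1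
  · exact (E.log_det_one_sub_weighted (fun _ _ => rfl) (fun _ _ => zero_le_one)
      fun _ _ => le_rfl).1

variable [MeasurableSpace X] [MeasurableSingletonClass X] {Ω : Type*} [MeasurableSpace Ω]
  {Pr : Measure Ω} {L : Ω → Measure (Loop X)} {α : ℝ}

theorem measurable_totalCrossings
    (hL : IsPoissonPoint Pr L (ENNReal.ofReal α • E.loopMeasure)) (x y : X) :
    Measurable fun ω => totalCrossings (L ω) x y :=
  (Measure.measurable_lintegral (measurable_crossings x y)).comp hL.measurable

variable [IsProbabilityMeasure Pr]

theorem lintegral_totalCrossings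
    (hL : IsPoissonPoint Pr L (ENNReal.ofReal α • E.loopMeasure)) (x y : X) :
    ∫⁻ ω, totalCrossings (L ω) x y ∂Pr =
      ENNReal.ofReal α * ∫⁻ l, (crossings x y l : ℝ≥0∞) ∂E.loopMeasure := by
  simp only [totalCrossings]
  rw [hL.lintegral_lintegral (measurable_crossings x y), lintegral_smul_measure, smul_eq_mul]

theorem ae_totalCrossings_ne_top
    (hL : IsPoissonPoint Pr L (ENNReal.ofReal α • E.loopMeasure)) :
    ∀ᵐ ω ∂Pr, ∀ x y, totalCrossings (L ω) x y ≠ ⊤ := by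
  refine ae_all_iff.2 fun x => ae_all_iff.2 fun y => ?_
  refine (ae_lt_top (E.measurable_totalCrossings hL x y) ?_).mono fun ω h => h.ne
  rw [E.lintegral_totalCrossings hL]
  exact ENNReal.mul_ne_top ENNReal.ofReal_ne_top (E.lintegral_crossings_lt_top x y).ne

/-- Almost surely the loops only step along links. -/
theorem ae_totalCrossings_eq_zero
    (hL : IsPoissonPoint Pr L (ENNReal.ofReal α • E.loopMeasure)) :
    ∀ᵐ ω ∂Pr, ∀ x y, E.C x y = 0 → totalCrossings (L ω) x y = 0 := by
  refine ae_all_iff.2 fun x => ae_all_iff.2 fun y => ?_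
  by_cases h : E.C x y = 0
  · have h0 : ∫⁻ ω, totalCrossings (L ω) x y ∂Pr = 0 := by
      rw [E.lintegral_totalCrossings hL, E.lintegral_crossings_eq_zero h, mul_zero]
    exact ((lintegral_eq_zero_iff (E.measurable_totalCrossings hL x y)).1 h0).mono
      fun ω hω _ => hω
  · exact Filter.Eventually.of_forall fun ω h' => absurd h' h

theorem lintegral_ofReal_sum_mul_crossings (m : Measure (Loop X)) {f : X → X → ℝ}
    (hf : ∀ x y, 0 ≤ f x y) :
    ∫⁻ l, ENNReal.ofReal (∑ x, ∑ y, f x y * crossings x y l) ∂m =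
      ∑ x, ∑ y, ENNReal.ofReal (f x y) * totalCrossings m x y := by
  have h : ∀ l : Loop X, ENNReal.ofReal (∑ x, ∑ y, f x y * crossings x y l) =
      ∑ x, ∑ y, ENNReal.ofReal (f x y) * crossings x y l := fun l => by
    have hn : ∀ x y, 0 ≤ f x y * crossings x y l := fun x y =>
      mul_nonneg (hf x y) (Nat.cast_nonneg _)
    rw [ENNReal.ofReal_sum_of_nonneg fun x _ => Finset.sum_nonneg fun y _ => hn x y]
    refine Finset.sum_congr rfl fun x _ => ?_
    rw [ENNReal.ofReal_sum_of_nonneg fun y _ => hn x y]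
    exact Finset.sum_congr rfl fun y _ => by
      rw [ENNReal.ofReal_mul (hf x y), ENNReal.ofReal_natCast]
  simp only [h, totalCrossings]
  have hm := measurable_crossings (X := X)
  rw [lintegral_finsetSum _ fun x _ => Finset.measurable_fun_sum _ fun y _ => (hm x y).const_mul _]
  refine Finset.sum_congr rfl fun x _ => ?_
  rw [lintegral_finsetSum _ fun y _ => (hm x y).const_mul _]
  exact Finset.sum_congr rfl fun y _ => lintegral_const_mul _ (hm x y)

/-- The exponential functional of the numbers of steps, as a ratio of determinants. -/
theorem integral_exp_neg_totalCrossings (hα : 0 < α)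
    (hL : IsPoissonPoint Pr L (ENNReal.ofReal α • E.loopMeasure)) {g : Sym2 (Option X) → ℝ}
    (hg : ∀ x y : X, 0 < E.C x y → 0 ≤ g s(some x, some y)) :
    ∫ ω, Real.exp (-∑ x, ∑ y,
        g s(some x, some y) * (totalCrossings (L ω) x y).toReal) ∂Pr =
      ((1 - E.weighted fun x y => Real.exp (-g s(some x, some y))).det /
        (1 - E.weighted fun _ _ => 1).det) ^ (-α) := by
  have hf := E.onLinks_nonneg hg
  set f := E.onLinks g with hfdef
  have hpos1 := (E.log_det_one_sub_weighted (w := fun _ _ => 1) (fun _ _ => rfl)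
    (fun _ _ => zero_le_one) fun _ _ => le_rfl).1
  have hpos2 := (E.log_det_one_sub_weighted (w := fun x y => Real.exp (-f x y))
    (fun x y => by rw [hfdef, E.onLinks_symm]) (fun _ _ => (Real.exp_pos _).le)
    fun x y => Real.exp_le_one_iff.2 (neg_nonpos.2 (hf x y))).1
  obtain ⟨hnn, hlog⟩ := E.lintegral_one_sub_exp f hf (E.onLinks_symm g)
  have hfin : ∫⁻ l, ENNReal.ofReal (∑ x, ∑ y, f x y * (crossingVector l x y))
      ∂(ENNReal.ofReal α • E.loopMeasure) ≠ ⊤ := by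
    rw [lintegral_smul_measure, smul_eq_mul]
    refine ENNReal.mul_ne_top ENNReal.ofReal_ne_top ?_
    refine ((lintegral_ofReal_sum_mul_crossings E.loopMeasure hf).trans_lt ?_).ne
    exact ENNReal.sum_lt_top.2 fun x _ => ENNReal.sum_lt_top.2 fun y _ =>
      ENNReal.mul_lt_top ENNReal.ofReal_lt_top (E.lintegral_crossings_lt_top x y)
  have key := hL.integral_exp_neg_lintegral measurable_crossingVector
    (h := fun c => ∑ x, ∑ y, f x y * c x y)
    (fun c => Finset.sum_nonneg fun x _ => Finset.sum_nonneg fun y _ =>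
      mul_nonneg (hf x y) (Nat.cast_nonneg _)) hfin
  have hright : ∫⁻ l, ENNReal.ofReal (1 - Real.exp (-∑ x, ∑ y, f x y * crossingVector l x y))
      ∂(ENNReal.ofReal α • E.loopMeasure) = ENNReal.ofReal α *
        ENNReal.ofReal (Real.log (1 - E.weighted fun x y => Real.exp (-f x y)).det -
          Real.log (1 - E.weighted fun _ _ => 1).det) := by
    rw [lintegral_smul_measure, smul_eq_mul, ← hlog]
    rfl
  rw [hright, ENNReal.toReal_mul, ENNReal.toReal_ofReal hα.le, ENNReal.toReal_ofReal hnn] at key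
  rw [← E.weighted_onLinks g, Real.rpow_def_of_pos (div_pos hpos2 hpos1),
    Real.log_div hpos2.ne' hpos1.ne', mul_neg, mul_comm _ α, ← key]
  -- Almost surely no step is made off the links and all counts are finite, so g may replace
  -- `onLinks g` and `toReal` commutes with the sums.
  refine integral_congr_ae ?_
  filter_upwards [E.ae_totalCrossings_ne_top hL, E.ae_totalCrossings_eq_zero hL] with ω h1 h2
  have h3 : ∫⁻ l, ENNReal.ofReal (∑ x, ∑ y, f x y * (crossingVector l x y)) ∂L ω =
      ∑ x, ∑ y, ENNReal.ofReal (f x y) * totalCrossings (L ω) x y :=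
    lintegral_ofReal_sum_mul_crossings (L ω) hf
  have h4 : ∀ x y, ENNReal.ofReal (f x y) * totalCrossings (L ω) x y ≠ ⊤ := fun x y =>
    ENNReal.mul_ne_top ENNReal.ofReal_ne_top (h1 x y)
  rw [h3, ENNReal.toReal_sum fun x _ => (ENNReal.sum_lt_top.2 fun y _ => (h4 x y).lt_top).ne]
  congr 2
  refine Finset.sum_congr rfl fun x _ => ?_
  rw [ENNReal.toReal_sum fun y _ => h4 x y]
  refine Finset.sum_congr rfl fun y _ => ?_
  rw [ENNReal.toReal_mul, ENNReal.toReal_ofReal (hf x y)]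
  by_cases h : E.C x y = 0
  · simp [h2 x y h]
  · simp [hfdef, onLinks, h]

/-- Almost surely the exponent is nonpositive, since pairs on which g may be negative are never
crossed; the variable is thus bounded by 1. -/
theorem integrable_exp_neg_totalCrossings
    (hL : IsPoissonPoint Pr L (ENNReal.ofReal α • E.loopMeasure)) {g : Sym2 (Option X) → ℝ}
    (hg : ∀ x y : X, 0 < E.C x y → 0 ≤ g s(some x, some y)) :
    Integrable (fun ω => Real.exp (-∑ x, ∑ y,
      g s(some x, some y) * (totalCrossings (L ω) x y).toReal)) Pr := by
  refine Integrable.mono' (integrable_const (1 : ℝ)) (Measurable.aestronglyMeasurable ?_) ?_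
  · exact (Finset.measurable_fun_sum _ fun x _ => Finset.measurable_fun_sum _ fun y _ =>
      (E.measurable_totalCrossings hL x y).ennreal_toReal.const_mul _).neg.exp
  · filter_upwards [E.ae_totalCrossings_eq_zero hL] with ω hω
    rw [Real.norm_eq_abs, Real.abs_exp, Real.exp_le_one_iff, neg_nonpos]
    refine Finset.sum_nonneg fun x _ => Finset.sum_nonneg fun y _ => ?_
    by_cases h : E.C x y = 0
    · simp [hω x y h]
    · exact mul_nonneg (hg x y (lt_of_le_of_ne (E.C_nonneg x y) (Ne.symm h)))
        ENNReal.toReal_nonneg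

end EnergyForm

end MarkovLoops

end

theorem mainTheorem6 {X : Type*} [Fintype X] [DecidableEq X] [MeasurableSpace X]
    [MeasurableSingletonClass X] (E : MarkovLoops.EnergyForm X)
    (g : Sym2 (Option X) → ℝ)
    (hg : ∀ x y : X, 0 < E.C x y → 0 ≤ g s(some x, some y))
    (α : ℝ) (hα : 0 < α)
    {Ω : Type*} [MeasurableSpace Ω] (Pr : Measure Ω) [IsProbabilityMeasure Pr]
    (L : Ω → Measure (MarkovLoops.Loop X))
    (hL : MarkovLoops.IsPoissonPoint Pr L (ENNReal.ofReal α • E.loopMeasure))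
    (o : MarkovLoops.Link X → Option X × Option X) (ho : MarkovLoops.IsOrientation o) :
    (∀ᵐ ω ∂Pr, ∀ x y, MarkovLoops.totalCrossings (L ω) x y ≠ ⊤) ∧
    Integrable (fun ω => Real.exp (-∑ x, ∑ y,
      g s(some x, some y) * (MarkovLoops.totalCrossings (L ω) x y).toReal)) Pr ∧
    0 < (1 + E.green * E.perturbation g).det ∧
    0 < (1 - E.transferMatrix o * E.multTilt g).det ∧
    (1 + E.green * E.perturbation g).det ^ (-α) =
      ∫ ω, Real.exp (-∑ x, ∑ y,
        g s(some x, some y) * (MarkovLoops.totalCrossings (L ω) x y).toReal) ∂Pr ∧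
    ∫ ω, Real.exp (-∑ x, ∑ y,
        g s(some x, some y) * (MarkovLoops.totalCrossings (L ω) x y).toReal) ∂Pr =
      (1 - E.transferMatrix o * E.multTilt g).det ^ (-α) := by
  have hdet : (1 - E.transferMatrix o * E.multTilt g).det =
      (1 + E.green * E.perturbation g).det := by
    -- When X is empty, λ_Δ = 0 and the recurrent chain degenerates, but there are no links either
    -- and both determinants are 1.
    cases isEmpty_or_nonempty X with
    | inl h =>
      have : IsEmpty (MarkovLoops.Link X) := ⟨fun ⟨z, hz⟩ => by
        induction z with
        | h a b => exact hz (by simp [Subsingleton.elim a b])⟩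
      simp
    | inr h => exact E.det_one_sub_transferMatrix_mul g ho
  have hint := E.integral_exp_neg_totalCrossings hα hL hg
  rw [← E.det_one_add_green_mul_perturbation g] at hint
  have hpos := E.det_one_add_green_mul_perturbation_pos hg
  exact ⟨E.ae_totalCrossings_ne_top hL, E.integrable_exp_neg_totalCrossings hL hg, hpos,
    hdet ▸ hpos, hint.symm, hdet ▸ hint⟩
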